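/- Let $\gamma_d$ denote the standard Gaussian measure on $\mathbb{R}^d$. For a Borel set $H\subseteq\mathbb{R}^d$ let $$\Gamma(H)=\liminf_{\delta\to 0^+}\frac{\gamma_d(H_\delta\setminus H)}{\delta}\in[0,\infty]$$ be its Gaussian surface area, where $H_\delta$ is the set of points at Euclidean distance less than $\delta$ from some point of $H$. For $\rho\in[0,1]$ let $T_\rho f(x)=\mathbb{E}_{z\sim\gamma_d}\,f(\rho x+\sqrt{1-\rho^2}\,z)$ be the Ornstein–Uhlenbeck operator, and for an integer $t\ge 0$ let $\Pi_{\le t}$ be the truncation of the Hermite expansion in $L^2(\gamma_d)$ to total degree at most $t$. There is a universal constant $C>0$ such that the following holds for every $d$. Let $\mathcal{H}$ be a class of Borel subsets of $\mathbb{R}^d$ with $\Gamma_{\mathcal H}:=\sup_{H\in\mathcal H}\Gamma(H)<\infty$. Then for every $H\in\mathcal H$ and every $\varepsilon\in(0,1/2)$ there is a polynomial $q_H:\mathbb{R}^d\to[0,\infty)$ with $$\mathbb{E}_{x\sim\gamma_d}\big|q_H(x)-\mathbf 1_H(x)\big|\le\varepsilon\qquad\text{and}\qquad \deg q_H\le C\,\frac{\Gamma_{\mathcal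 H}^2}{\varepsilon^2}\log\frac1\varepsilon .$$ Moreover, $q_H$ can be taken of the form $q_H=\tfrac14(1+p)^2$ with $p=\Pi_{\le t}\,T_\rho(2\cdot\mathbf 1_H-1)$ for some $\rho\in[0,1]$ and some integer $t\ge0$ such that $2t\le C\,\frac{\Gamma_{\mathcal H}^2}{\varepsilon^2}\log\frac1\varepsilon$ and $\mathbb{E}_{x\sim\gamma_d}|p(x)-(2\cdot\mathbf 1_H(x)-1)|\le\varepsilon$; thus $\deg p\le t$ and $\deg q_H\le 2t$, i.e. non-negativity costs at most a factor $2$ over the degree bound $t$ for the unconstrained approximation $p$. -/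

import Mathlib

open MeasureTheory ProbabilityTheory Filter Topology

noncomputable section

namespace GSAApprox

/-- Gaussian surface area of `H ⊆ ℝ^d`: the lower limit of `γ_d (H_δ \ H) / δ` as `δ → 0⁺`,
where `H_δ` is the Euclidean `δ`-neighbourhood of `H`. -/
def gaussianSurfaceArea {d : ℕ} (H : Set (EuclideanSpace ℝ (Fin d))) : ENNReal :=
  liminf (fun δ : ℝ =>
    stdGaussian (EuclideanSpace ℝ (Fin d)) (Metric.thickening δ H \ H) / ENNReal.ofReal δ)
    (𝓝[>] 0)

/-- The supremum of the Gaussian surface areas of the members of a class of sets. -/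
def classSurfaceArea {d : ℕ} (𝓗 : Set (Set (EuclideanSpace ℝ (Fin d)))) : ENNReal :=
  ⨆ H ∈ 𝓗, gaussianSurfaceArea H

/-- The `±1`-valued function `2 · 1_H - 1`. -/
def signFn {d : ℕ} (H : Set (EuclideanSpace ℝ (Fin d))) (x : EuclideanSpace ℝ (Fin d)) : ℝ :=
  2 * H.indicator (fun _ => (1 : ℝ)) x - 1

/-- The Ornstein–Uhlenbeck operator `T_ρ`. -/
def ornsteinUhlenbeck {d : ℕ} (ρ : ℝ) (f : EuclideanSpace ℝ (Fin d) → ℝ)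
    (x : EuclideanSpace ℝ (Fin d)) : ℝ :=
  ∫ z, f (ρ • x + √(1 - ρ ^ 2) • z) ∂(stdGaussian (EuclideanSpace ℝ (Fin d)))

/-- The value of a polynomial in `d` variables at a point of `ℝ^d`. -/
def evalAt {d : ℕ} (p : MvPolynomial (Fin d) ℝ) (x : EuclideanSpace ℝ (Fin d)) : ℝ :=
  MvPolynomial.eval (fun i => x i) p

/-- The multivariate (probabilists') Hermite polynomial `∏ i, He_{α i}(x_i)`. -/
def hermiteMv {d : ℕ} (α : Fin d → ℕ) : MvPolynomial (Fin d) ℝ :=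
  ∏ i, Polynomial.aeval (MvPolynomial.X i) (Polynomial.hermite (α i))

/-- The coefficient of `hermiteMv α` in the Hermite expansion of `g`; recall that
`hermiteMv α` has squared norm `∏ i, (α i)!` in `L²(γ_d)`. -/
def hermiteCoeff {d : ℕ} (g : EuclideanSpace ℝ (Fin d) → ℝ) (α : Fin d → ℕ) : ℝ :=
  (∫ x, g x * evalAt (hermiteMv α) x ∂(stdGaussian (EuclideanSpace ℝ (Fin d)))) /
    ∏ i, ((α i).factorial : ℝ)

/-- Truncation `Π_{≤ t} g` of the Hermite expansion of `g` to total degree at most `t`. -/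
def hermiteTrunc {d : ℕ} (t : ℕ) (g : EuclideanSpace ℝ (Fin d) → ℝ) :
    MvPolynomial (Fin d) ℝ :=
  ∑ k ∈ Finset.range (t + 1), ∑ α ∈ Finset.piAntidiag (Finset.univ : Finset (Fin d)) k,
    MvPolynomial.C (hermiteCoeff g α) * hermiteMv α

end GSAApprox

end

/-! Write `f = 2·1_H - 1` and `ρ = cos θ`. The polynomial `p = Π_{≤t} T_ρ f` has two sources of
error.

Smoothing error: `E|T_ρ f - f|` is at most the mean of `|f(cos θ x + sin θ z) - f(x)|` over
independent Gaussians `x, z`. Since `γ × γ` is invariant under rotations of the pair, this mean is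
subadditive in `θ`, so for a Lipschitz `g` it is bounded by `θ` times its infinitesimal rate, hence
by `θ E‖∇g‖` (`rotationVariation_le_integral_fderiv`). Replacing `1_H` by a cutoff of slope `1/δ`
supported on `H_δ`, and letting `δ → 0` along values realising the liminf, gives `2θΓ(H)` for `f`
(`rotationVariation_indicator_le`, `integral_abs_ornsteinUhlenbeck_sub_le`).

Truncation error: `T_ρ` multiplies Hermite coefficients of degree `k` by `ρ^k`, so Parseval bounds
the tail by `ρ^(t+1)` (`integral_abs_hermiteTrunc_sub_le`). Parseval needs completeness of the
Hermite system, proved through characteristic functions. Taking `θ` of order `ε/Γ` and `t` of order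
`θ⁻² log(1/ε)` makes both errors at most `ε/2`.

Non-negativity: `p` has the same mean as `f`, and `E p² ≤ 1 = E f²`. These two facts force
`E|(1+p)²/4 - 1_H| ≤ E|p - f|` (`integral_abs_sq_sub_indicator_le`), so squaring doubles the degree
without increasing the error bound. -/

namespace GSAApprox

/-! ### Hermite polynomials and the Gaussian measure on the line. -/

section OneDim

open Polynomial

theorem integrable_eval_gaussianReal (Q : ℝ[X]) :
    Integrable (fun x => Q.eval x) (gaussianReal 0 1) := by
  induction Q using Polynomial.induction_on' with
  | add p q hp hq => simpa only [eval_add] using hp.fun_add hq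
  | monomial n a =>
    simp only [eval_monomial]
    refine Integrable.const_mul ?_ a
    have h := (memLp_id_gaussianReal' (μ := 0) (v := 1) (n : ENNReal) (by simp)).integrable_norm_pow'
    refine h.mono' (by fun_prop) (ae_of_all _ fun x => ?_)
    simp

theorem integrable_eval_mul_gaussianPDFReal (Q : ℝ[X]) :
    Integrable (fun x => Q.eval x * gaussianPDFReal 0 1 x) := by
  have h := integrable_eval_gaussianReal Q
  rw [gaussianReal_of_var_ne_zero _ one_ne_zero,
    integrable_withDensity_iff_integrable_smul' (by fun_prop)
      (ae_of_all _ fun x => gaussianPDF_lt_top)] at h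
  simpa [toReal_gaussianPDF, mul_comm] using h

theorem hasDerivAt_gaussianPDFReal (x : ℝ) :
    HasDerivAt (gaussianPDFReal 0 1) (-(x * gaussianPDFReal 0 1 x)) x := by
  have h : HasDerivAt (fun y : ℝ => -(y - 0) ^ 2 / (2 * ((1 : NNReal) : ℝ))) (-x) x := by
    have := ((((hasDerivAt_id x).sub_const 0).pow 2).neg).div_const (2 * ((1 : NNReal) : ℝ))
    convert! this using 1
    simp
    ring
  have := h.exp.const_mul ((√(2 * Real.pi * ((1 : NNReal) : ℝ)))⁻¹)
  convert! this using 1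
  simp only [gaussianPDFReal]
  ring

/-- Gaussian integration by parts for polynomials. -/
theorem integral_X_mul_gaussianReal (Q : ℝ[X]) :
    ∫ x, x * Q.eval x ∂(gaussianReal 0 1) = ∫ x, (derivative Q).eval x ∂(gaussianReal 0 1) := by
  have h := integral_mul_deriv_eq_deriv_mul_of_integrable
    (u := fun x => Q.eval x) (v := gaussianPDFReal 0 1)
    (u' := fun x => (derivative Q).eval x) (v' := fun x => -(x * gaussianPDFReal 0 1 x))
    (fun x _ => Q.hasDerivAt x) (fun x _ => hasDerivAt_gaussianPDFReal x)
    (by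
      refine (integrable_eval_mul_gaussianPDFReal (-(X * Q))).congr (ae_of_all _ fun x => ?_)
      simp; ring)
    (integrable_eval_mul_gaussianPDFReal _) (integrable_eval_mul_gaussianPDFReal _)
  rw [integral_gaussianReal_eq_integral_smul one_ne_zero,
    integral_gaussianReal_eq_integral_smul one_ne_zero]
  simp only [smul_eq_mul]
  rw [show (∫ x, gaussianPDFReal 0 1 x * (x * Q.eval x))
      = -∫ x, Q.eval x * -(x * gaussianPDFReal 0 1 x) by
    rw [← integral_neg]; congr 1; ext x; ring, h, neg_neg]
  congr 1; ext x; ring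

theorem derivative_hermite_succ (n : ℕ) :
    derivative (hermite (n + 1)) = (n + 1 : ℤ[X]) * hermite n := by
  induction n with
  | zero => simp
  | succ n ih =>
    rw [hermite_succ (n + 1), derivative_sub, derivative_mul, derivative_X, ih, derivative_mul]
    have : derivative ((n : ℤ[X]) + 1) = 0 := by simp
    rw [this, hermite_succ n]
    push_cast
    ring

/-- The Hermite polynomials with real coefficients. -/
noncomputable def hermiteReal (n : ℕ) : ℝ[X] := (hermite n).map (Int.castRingHom ℝ)

theorem hermiteReal_zero : hermiteReal 0 = 1 := by simp [hermiteReal]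

theorem hermiteReal_succ (n : ℕ) :
    hermiteReal (n + 1) = X * hermiteReal n - derivative (hermiteReal n) := by
  simp [hermiteReal, hermite_succ, derivative_map]

theorem derivative_hermiteReal_succ (n : ℕ) :
    derivative (hermiteReal (n + 1)) = (n + 1 : ℝ[X]) * hermiteReal n := by
  rw [hermiteReal, derivative_map, derivative_hermite_succ]
  simp [hermiteReal]

theorem derivative_hermiteReal (n : ℕ) :
    derivative (hermiteReal n) = (n : ℝ[X]) * hermiteReal (n - 1) := by
  cases n with
  | zero => simp [hermiteReal]
  | succ n => simp [derivative_hermiteReal_succ]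

theorem aeval_hermite_eq_eval (n : ℕ) (x : ℝ) :
    aeval x (hermite n) = (hermiteReal n).eval x := by
  rw [hermiteReal, eval_map, aeval_def]; rfl

/-- By Gaussian integration by parts, `X - d/dx`, which raises the Hermite index, is the adjoint of
`d/dx`. Orthogonality and the norms `n!` follow by iteration. -/
theorem integral_hermiteReal_succ_mul (n : ℕ) (Q : ℝ[X]) :
    ∫ x, (hermiteReal (n + 1)).eval x * Q.eval x ∂(gaussianReal 0 1)
      = ∫ x, (hermiteReal n).eval x * (derivative Q).eval x ∂(gaussianReal 0 1) := by
  have h := integral_X_mul_gaussianReal (hermiteReal n * Q)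
  have h1 := integrable_eval_gaussianReal (X * (hermiteReal n * Q))
  have h2 := integrable_eval_gaussianReal (derivative (hermiteReal n) * Q)
  have h3 := integrable_eval_gaussianReal (hermiteReal n * derivative Q)
  simp only [eval_mul, eval_X] at h1 h2 h3
  simp only [derivative_mul, eval_mul, eval_add] at h
  rw [integral_add h2 h3] at h
  rw [← sub_eq_iff_eq_add'.mpr h, ← integral_sub h1 h2]
  congr 1; ext x
  rw [hermiteReal_succ]
  simp
  ring

theorem integral_hermiteReal_mul_of_lt {n m : ℕ} (h : m < n) :
    ∫ x, (hermiteReal n).eval x * (hermiteReal m).eval x ∂(gaussianReal 0 1) = 0 := by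
  induction n generalizing m with
  | zero => omega
  | succ n ih =>
    rw [integral_hermiteReal_succ_mul]
    cases m with
    | zero => simp [hermiteReal_zero]
    | succ m =>
      have := ih (m := m) (by omega)
      calc _ = ∫ x, (m + 1 : ℝ) * ((hermiteReal n).eval x * (hermiteReal m).eval x)
            ∂(gaussianReal 0 1) := by
              congr 1; ext x
              simp [derivative_hermiteReal_succ]
              ring
        _ = 0 := by rw [integral_const_mul, this, mul_zero]

theorem integral_hermiteReal_sq (n : ℕ) :
    ∫ x, (hermiteReal n).eval x * (hermiteReal n).eval x ∂(gaussianReal 0 1) = n.factorial := by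
  induction n with
  | zero => simp [hermiteReal_zero]
  | succ n ih =>
    rw [integral_hermiteReal_succ_mul, derivative_hermiteReal_succ, Nat.factorial_succ,
      Nat.cast_mul, ← ih, ← integral_const_mul]
    congr 1; ext x
    simp
    ring

theorem integral_hermiteReal_mul (n m : ℕ) :
    ∫ x, (hermiteReal n).eval x * (hermiteReal m).eval x ∂(gaussianReal 0 1)
      = if n = m then (n.factorial : ℝ) else 0 := by
  rcases lt_trichotomy n m with h | rfl | h
  · rw [if_neg h.ne]
    simpa [mul_comm] using integral_hermiteReal_mul_of_lt h
  · simpa using integral_hermiteReal_sq n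
  · rw [if_neg h.ne', integral_hermiteReal_mul_of_lt h]

/-- Hermite polynomials are eigenfunctions of the one-dimensional Ornstein–Uhlenbeck operator. -/
theorem integral_hermiteReal_mehler {ρ s : ℝ} (h : ρ ^ 2 + s ^ 2 = 1) (x : ℝ) (n : ℕ) :
    ∫ z, (hermiteReal n).eval (ρ * x + s * z) ∂(gaussianReal 0 1)
      = ρ ^ n * (hermiteReal n).eval x := by
  induction n using Nat.strong_induction_on with
  | _ n ih =>
  cases n with
  | zero => simp [hermiteReal_zero]
  | succ n =>
    set ℓ : ℝ[X] := C (ρ * x) + C s * X with hℓ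
    have hev (Q : ℝ[X]) (z : ℝ) : Q.eval (ρ * x + s * z) = (Q.comp ℓ).eval z := by
      simp [hℓ]
    have hstein := integral_X_mul_gaussianReal ((hermiteReal n).comp ℓ)
    have hd : derivative ((hermiteReal n).comp ℓ)
        = C (s * n) * (hermiteReal (n - 1)).comp ℓ := by
      rw [derivative_comp, derivative_hermiteReal]
      simp [hℓ]
      ring
    have hlow : (n : ℝ) * ∫ z, ((hermiteReal (n - 1)).comp ℓ).eval z ∂(gaussianReal 0 1)
        = n * (ρ ^ (n - 1) * (hermiteReal (n - 1)).eval x) := by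
      simp_rw [← ih (n - 1) (by omega), hev]
    have hn : ∫ z, ((hermiteReal n).comp ℓ).eval z ∂(gaussianReal 0 1)
        = ρ ^ n * (hermiteReal n).eval x := by
      simp_rw [← ih n (by omega), hev]
    rw [hd] at hstein
    simp only [eval_mul, eval_C, integral_const_mul] at hstein
    have hsplit : ∀ z : ℝ, (hermiteReal (n + 1)).eval (ρ * x + s * z)
        = (ρ * x) * ((hermiteReal n).comp ℓ).eval z + s * (z * ((hermiteReal n).comp ℓ).eval z)
          - n * ((hermiteReal (n - 1)).comp ℓ).eval z := by
      intro z
      rw [hermiteReal_succ, derivative_hermiteReal, ← hev, ← hev]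
      simp
      ring
    have i1 := integrable_eval_gaussianReal ((hermiteReal n).comp ℓ)
    have i2 := integrable_eval_gaussianReal (X * (hermiteReal n).comp ℓ)
    have i3 := integrable_eval_gaussianReal ((hermiteReal (n - 1)).comp ℓ)
    simp only [eval_mul, eval_X] at i2
    simp_rw [hsplit]
    rw [integral_sub ((i1.const_mul _).fun_add (i2.const_mul _)) (i3.const_mul _),
      integral_add (i1.const_mul _) (i2.const_mul _), integral_const_mul, integral_const_mul,
      integral_const_mul, hstein, hn]
    rw [hermiteReal_succ, derivative_hermiteReal]
    -- With `s² = 1 - ρ²` the lower-order terms combine to `-ρ² n ρ^(n-1) He_(n-1)(x)`, leaving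
    -- `ρ^(n+1) (x He_n(x) - n He_(n-1)(x))`, which is the recurrence for `He_(n+1)`.
    have hs : s * (s * n * ∫ z, ((hermiteReal (n - 1)).comp ℓ).eval z ∂(gaussianReal 0 1))
        = s ^ 2 * (n * (ρ ^ (n - 1) * (hermiteReal (n - 1)).eval x)) := by
      rw [← hlow]; ring
    rw [hs, hlow, show s ^ 2 = 1 - ρ ^ 2 by linarith]
    cases n with
    | zero => simp; ring
    | succ n => simp; ring

end OneDim

/-! ### The Hermite basis of `L²(γ_d)` and Parseval comparison. -/

section MultiDim

variable {d : ℕ}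

local notation "𝕍" => EuclideanSpace ℝ (Fin d)
local notation "γ" => stdGaussian (EuclideanSpace ℝ (Fin d))

theorem integral_prod_stdGaussian (F : Fin d → ℝ → ℝ) :
    ∫ x, ∏ i, F i (x i) ∂γ = ∏ i, ∫ t, F i t ∂(gaussianReal 0 1) := by
  rw [← map_pi_eq_stdGaussian]
  exact ((MeasurableEquiv.toLp 2 (Fin d → ℝ)).measurableEmbedding.integral_map _).trans
    (integral_fintype_prod_eq_prod (fun i t => F i t))

@[simp] theorem evalAt_C (a : ℝ) (x : 𝕍) : evalAt (MvPolynomial.C a) x = a := by simp [evalAt]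

@[simp] theorem evalAt_one (x : 𝕍) : evalAt 1 x = 1 := by simp [evalAt]

@[simp] theorem evalAt_X (i : Fin d) (x : 𝕍) : evalAt (MvPolynomial.X i) x = x i := by
  simp [evalAt]

@[simp] theorem evalAt_add (p q : MvPolynomial (Fin d) ℝ) (x : 𝕍) :
    evalAt (p + q) x = evalAt p x + evalAt q x := by simp [evalAt]

@[simp] theorem evalAt_mul (p q : MvPolynomial (Fin d) ℝ) (x : 𝕍) :
    evalAt (p * q) x = evalAt p x * evalAt q x := by simp [evalAt]

@[simp] theorem evalAt_pow (p : MvPolynomial (Fin d) ℝ) (n : ℕ) (x : 𝕍) :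
    evalAt (p ^ n) x = evalAt p x ^ n := by simp [evalAt]

theorem evalAt_sum {ι : Type*} (s : Finset ι) (p : ι → MvPolynomial (Fin d) ℝ) (x : 𝕍) :
    evalAt (∑ i ∈ s, p i) x = ∑ i ∈ s, evalAt (p i) x := by simp [evalAt]

theorem evalAt_hermiteMv (α : Fin d → ℕ) (x : 𝕍) :
    evalAt (hermiteMv α) x = ∏ i, (hermiteReal (α i)).eval (x i) := by
  simp only [evalAt, hermiteMv, map_prod]
  refine Finset.prod_congr rfl fun i _ => ?_
  rw [← aeval_hermite_eq_eval]
  rw [Polynomial.aeval_def, Polynomial.aeval_def, Polynomial.hom_eval₂, MvPolynomial.eval_X]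
  congr 1
  exact RingHom.ext_int _ _

theorem continuous_evalAt (p : MvPolynomial (Fin d) ℝ) : Continuous (evalAt p) := by
  unfold evalAt
  exact (MvPolynomial.continuous_eval p).comp (by fun_prop)

theorem measurable_evalAt (p : MvPolynomial (Fin d) ℝ) : Measurable (evalAt p) :=
  (continuous_evalAt p).measurable

theorem memLp_evalAt (p : MvPolynomial (Fin d) ℝ) (r : ENNReal) (hr : r ≠ ⊤) :
    MemLp (evalAt p) r γ := by
  induction p using MvPolynomial.induction_on generalizing r with
  | C a => simpa [funext (evalAt_C (d := d) a)] using memLp_const a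
  | add p q hp hq =>
    rw [show evalAt (p + q) = fun x => evalAt p x + evalAt q x from funext (evalAt_add p q)]
    exact (hp r hr).add (hq r hr)
  | mul_X p i hp =>
    rw [show evalAt (p * MvPolynomial.X i) = fun x => evalAt p x * x i by ext x; simp]
    have hX : MemLp (fun x : 𝕍 => x i) (2 * r) γ := by
      refine (IsGaussian.memLp_id γ (2 * r) (ENNReal.mul_ne_top (by simp) hr)).mono
        (by fun_prop) (ae_of_all _ fun x => ?_)
      exact PiLp.norm_apply_le x i
    have : ENNReal.HolderTriple (2 * r) (2 * r) r := ⟨by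
      rw [ENNReal.mul_inv (by simp) (by simp), ← add_mul, ENNReal.inv_two_add_inv_two, one_mul]⟩
    exact MemLp.mul hX (hp (2 * r) (ENNReal.mul_ne_top (by simp) hr))

theorem integrable_evalAt (p : MvPolynomial (Fin d) ℝ) : Integrable (evalAt p) γ :=
  memLp_one_iff_integrable.1 (memLp_evalAt p 1 (by simp))

theorem integrable_mul_evalAt {h : 𝕍 → ℝ} (hh : MemLp h 2 γ) (p : MvPolynomial (Fin d) ℝ) :
    Integrable (fun x => h x * evalAt p x) γ :=
  hh.integrable_mul (memLp_evalAt p 2 (by simp))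

theorem integral_hermiteMv_mul (α β : Fin d → ℕ) :
    ∫ x, evalAt (hermiteMv α) x * evalAt (hermiteMv β) x ∂γ
      = if α = β then ∏ i, ((α i).factorial : ℝ) else 0 := by
  simp_rw [evalAt_hermiteMv, ← Finset.prod_mul_distrib]
  rw [integral_prod_stdGaussian
    (fun i t => (hermiteReal (α i)).eval t * (hermiteReal (β i)).eval t)]
  simp_rw [integral_hermiteReal_mul]
  split_ifs with h
  · subst h; simp
  · obtain ⟨i, hi⟩ := Function.ne_iff.1 h
    exact Finset.prod_eq_zero (Finset.mem_univ i) (if_neg hi)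

/-- Hermite polynomials are eigenfunctions of the Ornstein–Uhlenbeck operator. -/
theorem integral_hermiteMv_mehler {ρ s : ℝ} (h : ρ ^ 2 + s ^ 2 = 1) (α : Fin d → ℕ) (x : 𝕍) :
    ∫ z, evalAt (hermiteMv α) (ρ • x + s • z) ∂γ
      = ρ ^ (∑ i, α i) * evalAt (hermiteMv α) x := by
  simp_rw [evalAt_hermiteMv]
  simp only [PiLp.add_apply, PiLp.smul_apply, smul_eq_mul]
  rw [integral_prod_stdGaussian (fun i t => (hermiteReal (α i)).eval (ρ * x i + s * t))]
  simp_rw [integral_hermiteReal_mehler h]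
  rw [Finset.prod_mul_distrib, Finset.prod_pow_eq_pow_sum]

theorem X_mul_hermite (n : ℕ) :
    Polynomial.X * Polynomial.hermite n
      = Polynomial.hermite (n + 1) + (n : Polynomial ℤ) * Polynomial.hermite (n - 1) := by
  rw [Polynomial.hermite_succ]
  cases n with
  | zero => simp
  | succ n => rw [derivative_hermite_succ]; simp

theorem X_mul_hermiteMv (i : Fin d) (α : Fin d → ℕ) :
    MvPolynomial.X i * hermiteMv α
      = hermiteMv (Function.update α i (α i + 1))
        + (α i : ℝ) • hermiteMv (Function.update α i (α i - 1)) := by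
  have key (n : ℕ) : hermiteMv (Function.update α i n)
      = Polynomial.aeval (MvPolynomial.X i) (Polynomial.hermite n)
        * ∏ j ∈ Finset.univ.erase i,
          Polynomial.aeval (MvPolynomial.X j : MvPolynomial (Fin d) ℝ)
            (Polynomial.hermite (α j)) := by
    rw [hermiteMv, ← Finset.mul_prod_erase _ _ (Finset.mem_univ i), Function.update_self]
    congr 1
    refine Finset.prod_congr rfl fun j hj => ?_
    rw [Function.update_of_ne (Finset.ne_of_mem_erase hj)]
  have hα := key (α i)
  rw [Function.update_eq_self] at hα
  have hX := congrArg (Polynomial.aeval (MvPolynomial.X i : MvPolynomial (Fin d) ℝ))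
    (X_mul_hermite (α i))
  simp only [map_mul, map_add, Polynomial.aeval_X, map_natCast] at hX
  rw [key, key, hα, ← mul_assoc, hX, add_mul, MvPolynomial.smul_eq_C_mul, map_natCast, mul_assoc]

/-- The span contains `1`, and by the three-term recurrence it is stable under multiplication by
each variable. -/
theorem span_hermiteMv :
    Submodule.span ℝ (Set.range (hermiteMv (d := d))) = ⊤ := by
  rw [eq_top_iff]
  rintro p -
  have hX : ∀ (i : Fin d) (q : MvPolynomial (Fin d) ℝ),
      q ∈ Submodule.span ℝ (Set.range (hermiteMv (d := d))) →
      q * MvPolynomial.X i ∈ Submodule.span ℝ (Set.range (hermiteMv (d := d))) := by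
    intro i q hq
    induction hq using Submodule.span_induction with
    | mem q hq =>
      obtain ⟨α, rfl⟩ := hq
      rw [mul_comm, X_mul_hermiteMv]
      exact add_mem (Submodule.subset_span ⟨_, rfl⟩)
        (Submodule.smul_mem _ _ (Submodule.subset_span ⟨_, rfl⟩))
    | zero => simp
    | add p q _ _ hp hq => rw [add_mul]; exact add_mem hp hq
    | smul a q _ hq => rw [smul_mul_assoc]; exact Submodule.smul_mem _ _ hq
  induction p using MvPolynomial.induction_on with
  | C a =>
    rw [MvPolynomial.C_eq_smul_one]
    refine Submodule.smul_mem _ _ (Submodule.subset_span ⟨0, ?_⟩)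
    simp [hermiteMv]
  | add p q hp hq => exact add_mem hp hq
  | mul_X p i hp => exact hX i p hp

theorem integral_mul_evalAt_eq_zero {h : 𝕍 → ℝ} (hh : MemLp h 2 γ)
    (h0 : ∀ α, ∫ x, h x * evalAt (hermiteMv α) x ∂γ = 0) (p : MvPolynomial (Fin d) ℝ) :
    ∫ x, h x * evalAt p x ∂γ = 0 := by
  have hp : p ∈ Submodule.span ℝ (Set.range (hermiteMv (d := d))) := by simp [span_hermiteMv]
  induction hp using Submodule.span_induction with
  | mem q hq => obtain ⟨α, rfl⟩ := hq; exact h0 α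
  | zero => simp [evalAt]
  | add p q _ _ hp hq =>
    simp_rw [evalAt_add, mul_add]
    rw [integral_add (integrable_mul_evalAt hh p) (integrable_mul_evalAt hh q), hp, hq, add_zero]
  | smul a q _ hq =>
    simp_rw [MvPolynomial.smul_eq_C_mul, evalAt_mul, evalAt_C, mul_left_comm _ a]
    rw [integral_const_mul, hq, mul_zero]

theorem memLp_exp_abs_inner (ξ : 𝕍) : MemLp (fun x : 𝕍 => Real.exp |inner ℝ x ξ|) 2 γ := by
  obtain ⟨c, hc, hint⟩ := IsGaussian.exists_integrable_exp_sq γ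
  rw [memLp_two_iff_integrable_sq (by fun_prop)]
  refine (hint.const_mul (Real.exp (‖ξ‖ ^ 2 / c))).mono' (by fun_prop) (ae_of_all _ fun x => ?_)
  rw [Real.norm_of_nonneg (by positivity), ← Real.exp_nat_mul, ← Real.exp_add, Real.exp_le_exp]
  have h1 := abs_real_inner_le_norm x ξ
  -- Weighted AM–GM, with `c` the Fernique exponent for which `exp(c‖x‖²)` is integrable.
  have h2 : 2 * (‖x‖ * ‖ξ‖) ≤ ‖ξ‖ ^ 2 / c + c * ‖x‖ ^ 2 := by
    have := sq_nonneg (‖ξ‖ - c * ‖x‖)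
    rw [div_add' _ _ _ hc.ne', le_div_iff₀ hc]
    nlinarith
  push_cast
  linarith

theorem integral_mul_inner_pow_eq_zero {h : 𝕍 → ℝ}
    (h0 : ∀ p, ∫ x, h x * evalAt p x ∂γ = 0) (ξ : 𝕍) (n : ℕ) :
    ∫ x, h x * (inner ℝ x ξ) ^ n ∂γ = 0 := by
  have hpow (x : 𝕍) :
      evalAt ((∑ i, MvPolynomial.C (ξ i) * MvPolynomial.X i) ^ n) x = (inner ℝ x ξ) ^ n := by
    simp [evalAt_sum, PiLp.inner_apply]
  have := h0 ((∑ i, MvPolynomial.C (ξ i) * MvPolynomial.X i) ^ n)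
  simp_rw [hpow] at this
  exact this

/-- Expand the exponential in powers of the inner product: every term integrates to zero. The sum
may be exchanged with the integral because the partial sums are dominated by `|h| exp|⟨x, ξ⟩|`, a
product of two `L²` functions. -/
theorem integral_mul_cexp_inner_eq_zero {h : 𝕍 → ℝ} (hh : MemLp h 2 γ)
    (h0 : ∀ p, ∫ x, h x * evalAt p x ∂γ = 0) (ξ : 𝕍) :
    ∫ x, (h x : ℂ) * Complex.exp (inner ℝ x ξ * Complex.I) ∂γ = 0 := by
  have hterm (n : ℕ) :
      ∫ x, (h x : ℂ) * (((inner ℝ x ξ : ℝ) * Complex.I) ^ n / n.factorial) ∂γ = 0 := by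
    calc _ = ∫ x, (Complex.I ^ n / n.factorial) * ((h x * (inner ℝ x ξ) ^ n : ℝ) : ℂ) ∂γ := by
          congr 1; ext x; push_cast; ring
      _ = 0 := by
        rw [integral_const_mul, integral_complex_ofReal, integral_mul_inner_pow_eq_zero h0]
        simp
  have hbound (n : ℕ) (x : 𝕍) :
      ‖(h x : ℂ) * (((inner ℝ x ξ : ℝ) * Complex.I) ^ n / n.factorial)‖
        ≤ |h x| * (|inner ℝ x ξ| ^ n / n.factorial) := by
    simp
  have hsumm (x : 𝕍) : HasSum (fun n : ℕ => |h x| * (|inner ℝ x ξ| ^ n / n.factorial))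
      (|h x| * Real.exp |inner ℝ x ξ|) := by
    rw [Real.exp_eq_exp_ℝ]
    exact (NormedSpace.expSeries_div_hasSum_exp (|inner ℝ x ξ| : ℝ)).mul_left _
  have hexp (x : 𝕍) :
      HasSum (fun n : ℕ => (h x : ℂ) * (((inner ℝ x ξ : ℝ) * Complex.I) ^ n / n.factorial))
        (h x * Complex.exp ((inner ℝ x ξ : ℝ) * Complex.I)) := by
    rw [Complex.exp_eq_exp_ℂ]
    exact (NormedSpace.expSeries_div_hasSum_exp ((inner ℝ x ξ : ℝ) * Complex.I)).mul_left _
  have hmeas (n : ℕ) : AEStronglyMeasurable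
      (fun x => (h x : ℂ) * (((inner ℝ x ξ : ℝ) * Complex.I) ^ n / n.factorial)) γ :=
    (Complex.continuous_ofReal.comp_aestronglyMeasurable hh.1).mul
      (Continuous.aestronglyMeasurable (by fun_prop))
  have hsum := hasSum_integral_of_dominated_convergence (μ := γ)
    (fun (n : ℕ) (x : 𝕍) => |h x| * (|inner ℝ x ξ| ^ n / n.factorial))
    hmeas (fun n => ae_of_all _ (hbound n)) (ae_of_all _ fun x => (hsumm x).summable)
    (by
      simp_rw [fun x => (hsumm x).tsum_eq]
      exact hh.abs.integrable_mul (memLp_exp_abs_inner ξ))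
    (ae_of_all _ hexp)
  simp_rw [hterm] at hsum
  exact hsum.unique hasSum_zero

/-- Polynomials are dense in `L²` of the standard Gaussian measure. -/
theorem ae_eq_zero_of_integral_mul_evalAt {h : 𝕍 → ℝ} (hh : MemLp h 2 γ)
    (h0 : ∀ p, ∫ x, h x * evalAt p x ∂γ = 0) : h =ᵐ[γ] 0 := by
  have hi : Integrable h γ := hh.integrable (by simp)
  have hfin : IsFiniteMeasure ((γ).withDensity fun x => ENNReal.ofReal (h x)) :=
    isFiniteMeasure_withDensity_ofReal hi.2
  have hfin' : IsFiniteMeasure ((γ).withDensity fun x => ENNReal.ofReal (-h x)) :=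
    isFiniteMeasure_withDensity_ofReal hi.neg.2
  have hm : AEMeasurable (fun x => ENNReal.ofReal (h x)) γ := hi.aemeasurable.ennreal_ofReal
  have hm' : AEMeasurable (fun x => ENNReal.ofReal (-h x)) γ := hi.aemeasurable.neg.ennreal_ofReal
  have hexp (ξ : 𝕍) {k : 𝕍 → ℝ} (hk : Integrable k γ) :
      Integrable (fun x => (ENNReal.ofReal (k x)).toReal •
        Complex.exp (inner ℝ x ξ * Complex.I)) γ := by
    simp_rw [ENNReal.toReal_ofReal']
    refine Integrable.mono' hk.abs
      ((hk.1.sup aestronglyMeasurable_const).smul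
        (Continuous.aestronglyMeasurable (by fun_prop))) (ae_of_all _ fun x => ?_)
    rw [norm_smul, Complex.norm_exp_ofReal_mul_I, mul_one, Real.norm_of_nonneg (le_max_right _ _)]
    exact max_le (le_abs_self _) (abs_nonneg _)
  -- The positive and negative parts of `h` are densities of finite measures. Their characteristic
  -- functions differ by the integral of `h` against the exponential, which vanishes, so the
  -- measures coincide.
  have key : (γ).withDensity (fun x => ENNReal.ofReal (h x))
      = (γ).withDensity (fun x => ENNReal.ofReal (-h x)) := by
    refine Measure.ext_of_charFun (funext fun ξ => ?_)
    rw [charFun_apply, charFun_apply,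
      integral_withDensity_eq_integral_toReal_smul₀ hm (by simp),
      integral_withDensity_eq_integral_toReal_smul₀ hm' (by simp),
      ← sub_eq_zero, ← integral_sub (hexp ξ hi) (hexp ξ (k := fun x => -h x) hi.neg), ← integral_mul_cexp_inner_eq_zero hh h0 ξ]
    congr 1; ext x
    rw [← sub_smul, ENNReal.toReal_ofReal', ENNReal.toReal_ofReal',
      max_zero_sub_eq_self, Complex.real_smul]
  rw [withDensity_eq_iff hm hm' hi.lintegral_lt_top.ne] at key
  filter_upwards [key] with x hx
  have := congrArg ENNReal.toReal hx
  rw [ENNReal.toReal_ofReal', ENNReal.toReal_ofReal'] at this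
  rcases le_total (h x) 0 with h | h <;> simp_all

theorem inner_toLp_toLp {u v : 𝕍 → ℝ} (hu : MemLp u 2 γ) (hv : MemLp v 2 γ) :
    inner ℝ (hu.toLp u) (hv.toLp v) = ∫ x, u x * v x ∂γ := by
  rw [L2.inner_def]
  refine integral_congr_ae ?_
  filter_upwards [hu.coeFn_toLp, hv.coeFn_toLp] with x h1 h2
  simp [h1, h2, mul_comm]

/-- The normalised Hermite polynomials as elements of `L²`. -/
noncomputable def hermiteLp (α : Fin d → ℕ) : Lp ℝ 2 γ :=
  (√(∏ i, ((α i).factorial : ℝ)))⁻¹ • (memLp_evalAt (hermiteMv α) 2 (by simp)).toLp _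

theorem inner_hermiteLp {u : 𝕍 → ℝ} (hu : MemLp u 2 γ) (α : Fin d → ℕ) :
    inner ℝ (hu.toLp u) (hermiteLp α)
      = (√(∏ i, ((α i).factorial : ℝ)))⁻¹ * ∫ x, u x * evalAt (hermiteMv α) x ∂γ := by
  rw [hermiteLp, inner_smul_right, inner_toLp_toLp]

theorem orthonormal_hermiteLp : Orthonormal ℝ (hermiteLp (d := d)) := by
  rw [orthonormal_iff_ite]
  intro α β
  rw [hermiteLp, inner_smul_left, inner_hermiteLp, integral_hermiteMv_mul]
  split_ifs with h
  · subst h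
    have : (0 : ℝ) < ∏ i, ((α i).factorial : ℝ) :=
      Finset.prod_pos fun i _ => by exact_mod_cast Nat.factorial_pos _
    rw [← mul_assoc]
    simp only [conj_trivial]
    rw [← mul_inv, Real.mul_self_sqrt this.le, inv_mul_cancel₀ this.ne']
  · simp

/-- The Hermite basis of `L²` of the standard Gaussian measure. -/
noncomputable def hermiteBasis : HilbertBasis (Fin d → ℕ) ℝ (Lp ℝ 2 γ) :=
  HilbertBasis.mkOfOrthogonalEqBot orthonormal_hermiteLp (by
    rw [eq_bot_iff]
    intro u hu
    rw [Submodule.mem_orthogonal'] at hu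
    have hmem := Lp.memLp u
    have h0 : ∀ α, ∫ x, u x * evalAt (hermiteMv α) x ∂γ = 0 := by
      intro α
      have h1 := hu _ (Submodule.subset_span ⟨α, rfl⟩)
      rw [← Lp.toLp_coeFn u hmem, inner_hermiteLp] at h1
      have : (0 : ℝ) < ∏ i, ((α i).factorial : ℝ) :=
        Finset.prod_pos fun i _ => by exact_mod_cast Nat.factorial_pos _
      simpa [(Real.sqrt_pos.2 this).ne'] using h1
    have := ae_eq_zero_of_integral_mul_evalAt hmem (integral_mul_evalAt_eq_zero hmem h0)
    rw [Submodule.mem_bot]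
    exact Lp.ext (this.trans (Lp.coeFn_zero _ _ _).symm))

theorem coe_hermiteBasis : ⇑(hermiteBasis (d := d)) = hermiteLp :=
  HilbertBasis.coe_mkOfOrthogonalEqBot _ _

/-- Comparison of `L²` norms through Hermite coefficients. -/
theorem integral_sq_le_of_hermite {u v : 𝕍 → ℝ} (hu : MemLp u 2 γ) (hv : MemLp v 2 γ) {c : ℝ}
    (h : ∀ α, |∫ x, u x * evalAt (hermiteMv α) x ∂γ|
      ≤ c * |∫ x, v x * evalAt (hermiteMv α) x ∂γ|) :
    ∫ x, u x ^ 2 ∂γ ≤ c ^ 2 * ∫ x, v x ^ 2 ∂γ := by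
  have hs {w : 𝕍 → ℝ} (hw : MemLp w 2 γ) :
      HasSum (fun α => ((√(∏ i, ((α i).factorial : ℝ)))⁻¹ *
        ∫ x, w x * evalAt (hermiteMv α) x ∂γ) ^ 2) (∫ x, w x ^ 2 ∂γ) := by
    have := (hermiteBasis (d := d)).hasSum_inner_mul_inner (hw.toLp w) (hw.toLp w)
    simp_rw [real_inner_comm (hw.toLp w) (hermiteBasis _)] at this
    simpa only [coe_hermiteBasis, inner_hermiteLp, inner_toLp_toLp, ← pow_two] using this
  refine hasSum_le (fun α => ?_) (hs hu) ((hs hv).mul_left (c ^ 2))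
  rw [mul_pow, mul_pow, mul_left_comm, ← mul_pow c]
  refine mul_le_mul_of_nonneg_left ?_ (by positivity)
  rw [← sq_abs (∫ x, u x * _ ∂γ), ← sq_abs (c * _), abs_mul]
  refine pow_le_pow_left₀ (abs_nonneg _) ((h α).trans ?_) 2
  exact mul_le_mul_of_nonneg_right (le_abs_self c) (abs_nonneg _)

end MultiDim

/-! ### The Ornstein–Uhlenbeck operator on Hermite coefficients, and truncation. -/

section Smoothing

variable {d : ℕ}

local notation "𝕍" => EuclideanSpace ℝ (Fin d)
local notation "γ" => stdGaussian (EuclideanSpace ℝ (Fin d))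

theorem map_rotation_stdGaussian (θ : ℝ) :
    ((γ).prod γ).map (ContinuousLinearMap.rotation θ) = (γ).prod γ :=
  IsGaussian.map_rotation_eq_self (by simp) θ

theorem measurePreserving_rotation (θ : ℝ) :
    MeasurePreserving (fun w : 𝕍 × 𝕍 => ContinuousLinearMap.rotation θ w)
      ((γ).prod γ) ((γ).prod γ) :=
  ⟨by fun_prop, map_rotation_stdGaussian θ⟩

theorem integral_comp_rotation (θ : ℝ) {F : 𝕍 × 𝕍 → ℝ}
    (hF : AEStronglyMeasurable F ((γ).prod γ)) :
    ∫ w, F (ContinuousLinearMap.rotation θ w) ∂((γ).prod γ) = ∫ w, F w ∂((γ).prod γ) := by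
  conv_rhs => rw [← map_rotation_stdGaussian θ]
  rw [integral_map (by fun_prop) (by rwa [map_rotation_stdGaussian])]

theorem ornsteinUhlenbeck_cos {θ : ℝ} (h0 : 0 ≤ θ) (hπ : θ ≤ Real.pi) (f : 𝕍 → ℝ) (x : 𝕍) :
    ornsteinUhlenbeck (Real.cos θ) f x = ∫ z, f (Real.cos θ • x + Real.sin θ • z) ∂γ := by
  rw [ornsteinUhlenbeck, ← Real.sin_eq_sqrt_one_sub_cos_sq h0 hπ]

theorem stronglyMeasurable_ornsteinUhlenbeck (ρ : ℝ) {f : 𝕍 → ℝ} (hf : Measurable f) :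
    StronglyMeasurable (ornsteinUhlenbeck ρ f) := by
  have : Measurable fun w : 𝕍 × 𝕍 => f (ρ • w.1 + √(1 - ρ ^ 2) • w.2) := hf.comp (by fun_prop)
  exact this.stronglyMeasurable.integral_prod_right'

theorem abs_ornsteinUhlenbeck_le (ρ : ℝ) {f : 𝕍 → ℝ} (hb : ∀ x, |f x| ≤ 1) (x : 𝕍) :
    |ornsteinUhlenbeck ρ f x| ≤ 1 := by
  have := norm_integral_le_of_norm_le_const (μ := γ) (C := 1)
    (f := fun z => f (ρ • x + √(1 - ρ ^ 2) • z)) (ae_of_all _ fun z => hb _)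
  simpa [ornsteinUhlenbeck] using this

theorem memLp_of_abs_le_one {f : 𝕍 → ℝ} (hf : AEStronglyMeasurable f γ) (hb : ∀ x, |f x| ≤ 1)
    (r : ENNReal) : MemLp f r γ :=
  MemLp.of_bound hf 1 (ae_of_all _ hb)

theorem memLp_ornsteinUhlenbeck (ρ : ℝ) {f : 𝕍 → ℝ} (hf : Measurable f) (hb : ∀ x, |f x| ≤ 1)
    (r : ENNReal) : MemLp (ornsteinUhlenbeck ρ f) r γ :=
  memLp_of_abs_le_one (stronglyMeasurable_ornsteinUhlenbeck ρ hf).aestronglyMeasurable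
    (abs_ornsteinUhlenbeck_le ρ hb) r

/-- The Ornstein–Uhlenbeck operator multiplies the Hermite coefficient of index `α` by
`ρ ^ |α|`. -/
theorem integral_ornsteinUhlenbeck_mul_hermiteMv {θ : ℝ} (h0 : 0 ≤ θ) (hπ : θ ≤ Real.pi)
    {f : 𝕍 → ℝ} (hf : Measurable f) (hb : ∀ x, |f x| ≤ 1) (α : Fin d → ℕ) :
    ∫ x, ornsteinUhlenbeck (Real.cos θ) f x * evalAt (hermiteMv α) x ∂γ
      = Real.cos θ ^ (∑ i, α i) * ∫ x, f x * evalAt (hermiteMv α) x ∂γ := by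
  set c := Real.cos θ with hc
  set s := Real.sin θ with hs
  have hcs : c * c + s * s = 1 := by
    have := Real.cos_sq_add_sin_sq θ
    rw [← hc, ← hs] at this; linarith
  -- `F` is the integrand seen in rotated coordinates: the combination with `-s` undoes the rotation
  -- by `θ`, moving the noise from `f` to the Hermite polynomial, where the Mehler identity applies.
  let F : 𝕍 × 𝕍 → ℝ := fun w => f w.1 * evalAt (hermiteMv α) (c • w.1 + (-s) • w.2)
  have hFm : Measurable F := by
    refine (hf.comp measurable_fst).mul ((measurable_evalAt _).comp ?_)
    fun_prop
  have hcomp (w : 𝕍 × 𝕍) : F (ContinuousLinearMap.rotation θ w)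
      = f (c • w.1 + s • w.2) * evalAt (hermiteMv α) w.1 := by
    simp only [F, ContinuousLinearMap.rotation_apply, ← hc, ← hs]
    congr 2
    rw [smul_add, smul_add, smul_smul, smul_smul, smul_smul, smul_smul]
    rw [show (-s * -s) = s * s by ring, show -s * c = -(c * s) by ring, neg_smul]
    calc _ = (c * c + s * s) • w.1 := by rw [add_smul]; abel
      _ = w.1 := by rw [hcs, one_smul]
  have hint : Integrable (fun w : 𝕍 × 𝕍 => f (c • w.1 + s • w.2) * evalAt (hermiteMv α) w.1)
      ((γ).prod γ) := by
    refine (((integrable_evalAt (hermiteMv α)).comp_fst γ)).bdd_mul (c := 1) ?_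
      (ae_of_all _ fun w => hb _)
    exact (hf.comp (by fun_prop)).aestronglyMeasurable
  have hFint : Integrable F ((γ).prod γ) := by
    rw [← (measurePreserving_rotation θ).integrable_comp hFm.aestronglyMeasurable]
    exact hint.congr (ae_of_all _ fun w => (hcomp w).symm)
  calc _ = ∫ x, ∫ z, f (c • x + s • z) * evalAt (hermiteMv α) x ∂γ ∂γ := by
        congr 1; ext x
        rw [ornsteinUhlenbeck_cos h0 hπ, integral_mul_const]
    _ = ∫ w, f (c • w.1 + s • w.2) * evalAt (hermiteMv α) w.1 ∂((γ).prod γ) :=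
        (integral_prod _ hint).symm
    _ = ∫ w, F w ∂((γ).prod γ) := by
        rw [← integral_comp_rotation θ hFm.aestronglyMeasurable]
        simp_rw [hcomp]
    _ = ∫ x, ∫ z, F (x, z) ∂γ ∂γ := integral_prod _ hFint
    _ = ∫ x, c ^ (∑ i, α i) * (f x * evalAt (hermiteMv α) x) ∂γ := by
        congr 1; ext x
        simp only [F]
        rw [integral_const_mul, integral_hermiteMv_mehler (by linarith)]
        ring
    _ = _ := integral_const_mul _ _

theorem evalAt_hermiteTrunc (t : ℕ) (g : 𝕍 → ℝ) (x : 𝕍) :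
    evalAt (hermiteTrunc t g) x = ∑ k ∈ Finset.range (t + 1),
      ∑ α ∈ Finset.piAntidiag (Finset.univ : Finset (Fin d)) k,
        hermiteCoeff g α * evalAt (hermiteMv α) x := by
  simp [hermiteTrunc, evalAt_sum]

/-- Hermite coefficients of the truncation. -/
theorem integral_hermiteTrunc_mul (t : ℕ) (g : 𝕍 → ℝ) (β : Fin d → ℕ) :
    ∫ x, evalAt (hermiteTrunc t g) x * evalAt (hermiteMv β) x ∂γ
      = if ∑ i, β i ≤ t then ∫ x, g x * evalAt (hermiteMv β) x ∂γ else 0 := by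
  have hpos : (0 : ℝ) < ∏ i, ((β i).factorial : ℝ) :=
    Finset.prod_pos fun i _ => by exact_mod_cast Nat.factorial_pos _
  have hi (α : Fin d → ℕ) : Integrable (fun x => hermiteCoeff g α *
      (evalAt (hermiteMv α) x * evalAt (hermiteMv β) x)) γ := by
    simp_rw [← evalAt_mul]
    exact (integrable_evalAt _).const_mul _
  simp_rw [evalAt_hermiteTrunc, Finset.sum_mul, mul_assoc]
  rw [integral_finsetSum _ fun k _ => integrable_finsetSum _ fun α _ => hi α]
  simp_rw [fun k => integral_finsetSum (Finset.piAntidiag (Finset.univ : Finset (Fin d)) k)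
    fun α _ => hi α, integral_const_mul, integral_hermiteMv_mul, mul_ite, mul_zero,
    Finset.sum_ite_eq', Finset.mem_piAntidiag]
  simp only [Finset.mem_univ, implies_true, and_true, Finset.sum_ite_eq, Finset.mem_range,
    Nat.lt_succ_iff]
  refine if_congr Iff.rfl ?_ rfl
  rw [hermiteCoeff, div_mul_cancel₀ _ hpos.ne']

theorem totalDegree_aeval_X_le (i : Fin d) (P : Polynomial ℤ) :
    (Polynomial.aeval (MvPolynomial.X i : MvPolynomial (Fin d) ℝ) P).totalDegree
      ≤ P.natDegree := by
  rw [Polynomial.aeval_eq_sum_range]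
  refine MvPolynomial.totalDegree_finsetSum_le fun k hk => ?_
  rw [zsmul_eq_mul, ← map_intCast (MvPolynomial.C : ℝ →+* MvPolynomial (Fin d) ℝ)]
  refine (MvPolynomial.totalDegree_mul _ _).trans ?_
  rw [MvPolynomial.totalDegree_C, zero_add, MvPolynomial.totalDegree_X_pow]
  exact Nat.lt_succ_iff.1 (Finset.mem_range.1 hk)

theorem totalDegree_hermiteMv_le (α : Fin d → ℕ) : (hermiteMv α).totalDegree ≤ ∑ i, α i := by
  refine (MvPolynomial.totalDegree_finsetProd _ _).trans (Finset.sum_le_sum fun i _ => ?_)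
  exact (totalDegree_aeval_X_le i _).trans Polynomial.natDegree_hermite.le

theorem totalDegree_hermiteTrunc_le (t : ℕ) (g : 𝕍 → ℝ) : (hermiteTrunc t g).totalDegree ≤ t := by
  refine MvPolynomial.totalDegree_finsetSum_le fun k hk =>
    MvPolynomial.totalDegree_finsetSum_le fun α hα => ?_
  refine (MvPolynomial.totalDegree_mul _ _).trans ?_
  rw [MvPolynomial.totalDegree_C, zero_add]
  refine (totalDegree_hermiteMv_le α).trans ?_
  rw [(Finset.mem_piAntidiag.1 hα).1]
  exact Nat.lt_succ_iff.1 (Finset.mem_range.1 hk)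

/-- Cauchy–Schwarz on a probability space, in the form that the variance of `|u|` is non-negative.
-/
theorem integral_abs_le_of_integral_sq_le {Ω : Type*} [MeasurableSpace Ω] {μ : Measure Ω}
    [IsProbabilityMeasure μ] {u : Ω → ℝ} (hu : MemLp u 2 μ) {c : ℝ} (hc : 0 ≤ c)
    (h : ∫ x, u x ^ 2 ∂μ ≤ c ^ 2) : ∫ x, |u x| ∂μ ≤ c := by
  have hv := variance_nonneg |u| μ
  rw [variance_eq_sub hu.abs] at hv
  simp only [Pi.pow_apply, Pi.abs_apply, sq_abs] at hv
  exact abs_le_of_sq_le_sq' (by linarith) hc |>.2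

theorem integral_sq_le_one {f : 𝕍 → ℝ} (hf : Measurable f) (hb : ∀ x, |f x| ≤ 1) :
    ∫ x, f x ^ 2 ∂γ ≤ 1 := by
  have := integral_mono (memLp_of_abs_le_one hf.aestronglyMeasurable hb 2).integrable_sq
    (integrable_const (1 : ℝ)) fun x => (sq_le_one_iff_abs_le_one _).2 (hb x)
  simpa using this

section Trunc

variable {θ : ℝ} {f : EuclideanSpace ℝ (Fin d) → ℝ}

/-- The mean is the Hermite coefficient of index `0`, which neither truncation nor `T_ρ` changes.
Equality of means is what makes the linear terms cancel when `1 + p` is squared. -/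
theorem integral_hermiteTrunc_ornsteinUhlenbeck (h0 : 0 ≤ θ) (hπ : θ ≤ Real.pi)
    (hf : Measurable f) (hb : ∀ x, |f x| ≤ 1) (t : ℕ) :
    ∫ x, evalAt (hermiteTrunc t (ornsteinUhlenbeck (Real.cos θ) f)) x ∂γ = ∫ x, f x ∂γ := by
  have h := integral_hermiteTrunc_mul t (ornsteinUhlenbeck (Real.cos θ) f) (0 : Fin d → ℕ)
  rw [integral_ornsteinUhlenbeck_mul_hermiteMv h0 hπ hf hb] at h
  simpa [evalAt_hermiteMv, hermiteReal_zero] using h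

theorem integral_sq_hermiteTrunc_le (h0 : 0 ≤ θ) (hπ : θ ≤ Real.pi)
    (hf : Measurable f) (hb : ∀ x, |f x| ≤ 1) (t : ℕ) :
    ∫ x, evalAt (hermiteTrunc t (ornsteinUhlenbeck (Real.cos θ) f)) x ^ 2 ∂γ ≤ 1 := by
  have h := integral_sq_le_of_hermite (c := 1)
    (memLp_evalAt (hermiteTrunc t (ornsteinUhlenbeck (Real.cos θ) f)) 2 (by simp))
    (memLp_of_abs_le_one hf.aestronglyMeasurable hb 2) (fun α => by
      rw [integral_hermiteTrunc_mul, integral_ornsteinUhlenbeck_mul_hermiteMv h0 hπ hf hb, one_mul]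
      split_ifs
      · rw [abs_mul, abs_pow]
        exact mul_le_of_le_one_left (abs_nonneg _)
          (pow_le_one₀ (abs_nonneg _) (Real.abs_cos_le_one θ))
      · simp)
  linarith [integral_sq_le_one hf hb]

/-- The Hermite tail of `T_ρ f` above degree `t` is at most `ρ ^ (t + 1)`. -/
theorem integral_abs_hermiteTrunc_sub_le (h0 : 0 ≤ θ) (hπ : θ ≤ Real.pi / 2)
    (hf : Measurable f) (hb : ∀ x, |f x| ≤ 1) (t : ℕ) :
    ∫ x, |evalAt (hermiteTrunc t (ornsteinUhlenbeck (Real.cos θ) f)) x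
      - ornsteinUhlenbeck (Real.cos θ) f x| ∂γ ≤ Real.cos θ ^ (t + 1) := by
  have hcos : 0 ≤ Real.cos θ := Real.cos_nonneg_of_mem_Icc ⟨by linarith, hπ⟩
  have hπ' : θ ≤ Real.pi := by linarith
  set g := ornsteinUhlenbeck (Real.cos θ) f
  have hp := memLp_evalAt (hermiteTrunc t g) 2 (by simp)
  have hg : MemLp g 2 γ := memLp_ornsteinUhlenbeck _ hf hb 2
  refine integral_abs_le_of_integral_sq_le (hp.sub hg) (by positivity) ?_
  have h := integral_sq_le_of_hermite (c := Real.cos θ ^ (t + 1)) (hp.sub hg)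
    (memLp_of_abs_le_one hf.aestronglyMeasurable hb 2) (fun α => by
      simp only [Pi.sub_apply, sub_mul]
      rw [integral_sub (integrable_mul_evalAt hp _) (integrable_mul_evalAt hg _),
        integral_hermiteTrunc_mul, integral_ornsteinUhlenbeck_mul_hermiteMv h0 hπ' hf hb]
      split_ifs with hα
      · simp; positivity
      -- A surviving index has `|α| ≥ t + 1`, and `0 ≤ cos θ ≤ 1`, so its factor is at most `cos θ ^
      -- (t + 1)`.
      · rw [zero_sub, abs_neg, abs_mul, abs_pow, abs_of_nonneg hcos]
        exact mul_le_mul_of_nonneg_right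
          (pow_le_pow_of_le_one hcos (Real.cos_le_one θ) (by omega)) (abs_nonneg _))
  refine h.trans (mul_le_of_le_one_right (by positivity) (integral_sq_le_one hf hb))

end Trunc

end Smoothing

/-! ### Noise sensitivity bounded by Gaussian surface area. -/

section SurfaceArea

variable {d : ℕ}

local notation "𝕍" => EuclideanSpace ℝ (Fin d)
local notation "γ" => stdGaussian (EuclideanSpace ℝ (Fin d))

/-- Used to see that Lebesgue-null sets are `γ`-null, so that Rademacher's theorem holds `γ`-almost
everywhere. -/
theorem pi_absolutelyContinuous {n : ℕ} {μ ν : Measure ℝ} [SigmaFinite μ] [SigmaFinite ν]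
    (h : μ ≪ ν) : Measure.pi (fun _ : Fin n => μ) ≪ Measure.pi (fun _ : Fin n => ν) := by
  induction n with
  | zero => rw [Measure.pi_of_empty _ 0, Measure.pi_of_empty _ 0]
  | succ n ih =>
    have hμ := (measurePreserving_piFinSuccAbove (fun _ : Fin (n + 1) => μ) 0).symm
    have hν := (measurePreserving_piFinSuccAbove (fun _ : Fin (n + 1) => ν) 0).symm
    rw [← hμ.map_eq, ← hν.map_eq]
    exact (h.prod ih).map (MeasurableEquiv.measurable _)

theorem stdGaussian_absolutelyContinuous : γ ≪ volume := by
  rw [← map_pi_eq_stdGaussian, ← (PiLp.volume_preserving_toLp (Fin d)).map_eq]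
  exact (pi_absolutelyContinuous (gaussianReal_absolutelyContinuous 0 one_ne_zero)).map
    (by fun_prop)

/-- The mean variation of `g` along a rotation by the angle `θ` in Gauss space. -/
noncomputable def rotationVariation (g : 𝕍 → ℝ) (θ : ℝ) : ℝ :=
  ∫ w, |g (Real.cos θ • w.1 + Real.sin θ • w.2) - g w.1| ∂((γ).prod γ)

theorem integrable_of_abs_le {Ω : Type*} [MeasurableSpace Ω] {μ : Measure Ω} [IsFiniteMeasure μ]
    {u : Ω → ℝ} (hu : Measurable u) {c : ℝ} (hb : ∀ x, |u x| ≤ c) : Integrable u μ :=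
  Integrable.of_bound hu.aestronglyMeasurable c (ae_of_all _ hb)

theorem integrable_rotation_abs_sub {g h : 𝕍 → ℝ} (hg : Measurable g) (hb : ∀ x, |g x| ≤ 1)
    (hh : Measurable h) (hb' : ∀ x, |h x| ≤ 1) (a b : ℝ) :
    Integrable (fun w : 𝕍 × 𝕍 => |g (Real.cos a • w.1 + Real.sin a • w.2)
      - h (Real.cos b • w.1 + Real.sin b • w.2)|) ((γ).prod γ) := by
  refine integrable_of_abs_le (c := 2) ?_ fun w => ?_
  · have h1 : Measurable fun w : 𝕍 × 𝕍 => g (Real.cos a • w.1 + Real.sin a • w.2) :=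
      hg.comp (by fun_prop)
    have h2 : Measurable fun w : 𝕍 × 𝕍 => h (Real.cos b • w.1 + Real.sin b • w.2) :=
      hh.comp (by fun_prop)
    exact measurable_norm.comp (h1.sub h2)
  · rw [abs_abs]
    refine (abs_sub _ _).trans ?_
    linarith [hb (Real.cos a • w.1 + Real.sin a • w.2), hb' (Real.cos b • w.1 + Real.sin b • w.2)]

theorem cos_smul_rotation (a b : ℝ) (w : 𝕍 × 𝕍) :
    Real.cos b • (ContinuousLinearMap.rotation a w).1
      + Real.sin b • (ContinuousLinearMap.rotation a w).2
      = Real.cos (a + b) • w.1 + Real.sin (a + b) • w.2 := by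
  simp only [ContinuousLinearMap.rotation_apply, Real.cos_add, Real.sin_add]
  module

/-- Rotation invariance of `γ × γ` makes the mean increment between two angles depend only on their
difference. -/
theorem rotationVariation_eq_integral_rotation {g : 𝕍 → ℝ} (hg : Measurable g)
    (a b : ℝ) :
    ∫ w, |g (Real.cos (a + b) • w.1 + Real.sin (a + b) • w.2)
      - g (Real.cos a • w.1 + Real.sin a • w.2)| ∂((γ).prod γ) = rotationVariation g b := by
  have hm : Measurable fun w : 𝕍 × 𝕍 =>
      |g (Real.cos b • w.1 + Real.sin b • w.2) - g w.1| := by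
    have h1 : Measurable fun w : 𝕍 × 𝕍 => g (Real.cos b • w.1 + Real.sin b • w.2) :=
      hg.comp (by fun_prop)
    exact measurable_norm.comp (h1.sub (hg.comp measurable_fst))
  rw [rotationVariation, ← integral_comp_rotation a hm.aestronglyMeasurable]
  simp_rw [cos_smul_rotation]
  rfl

/-- Triangle inequality through the point at angle `a`, together with stationarity of the
increments. -/
theorem rotationVariation_add_le {g : 𝕍 → ℝ} (hg : Measurable g) (hb : ∀ x, |g x| ≤ 1)
    (a b : ℝ) : rotationVariation g (a + b) ≤ rotationVariation g a + rotationVariation g b := by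
  have h0 (c : ℝ) : Integrable (fun w : 𝕍 × 𝕍 =>
      |g (Real.cos c • w.1 + Real.sin c • w.2) - g w.1|) ((γ).prod γ) := by
    simpa using integrable_rotation_abs_sub hg hb hg hb c 0
  rw [← rotationVariation_eq_integral_rotation hg a b, add_comm (rotationVariation g a),
    rotationVariation, rotationVariation, ← integral_add (integrable_rotation_abs_sub hg hb hg hb _ _) (h0 a)]
  exact integral_mono (h0 _) ((integrable_rotation_abs_sub hg hb hg hb _ _).add (h0 a))
    fun w => abs_sub_le _ _ _

theorem rotationVariation_nat_mul_le {g : 𝕍 → ℝ} (hg : Measurable g) (hb : ∀ x, |g x| ≤ 1)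
    (n : ℕ) (a : ℝ) : rotationVariation g (n * a) ≤ n * rotationVariation g a := by
  induction n with
  | zero => simp [rotationVariation]
  | succ n ih =>
    push_cast
    rw [add_mul, one_mul, add_mul, one_mul]
    exact (rotationVariation_add_le hg hb _ _).trans (by linarith)

theorem hasDerivAt_rotation {g : 𝕍 → ℝ} {x : 𝕍} (hx : DifferentiableAt ℝ g x) (z : 𝕍) :
    HasDerivAt (fun s => g (Real.cos s • x + Real.sin s • z)) (fderiv ℝ g x z) 0 := by
  have h1 : HasDerivAt (fun s => Real.cos s • x + Real.sin s • z) z 0 := by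
    have := ((Real.hasDerivAt_cos 0).smul_const x).fun_add
      ((Real.hasDerivAt_sin 0).smul_const z)
    rwa [Real.sin_zero, neg_zero, zero_smul, zero_add, Real.cos_zero, one_smul] at this
  have h2 : HasFDerivAt g (fderiv ℝ g x) (Real.cos 0 • x + Real.sin 0 • z) := by
    simpa using hx.hasFDerivAt
  exact h2.comp_hasDerivAt 0 h1

theorem abs_rotation_sub_le {K : NNReal} {g : 𝕍 → ℝ} (hK : LipschitzWith K g) (s : ℝ) (x z : 𝕍) :
    |g (Real.cos s • x + Real.sin s • z) - g x| ≤ |s| * (K * (‖x‖ + ‖z‖)) := by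
  have h1 := hK.dist_le_mul (Real.cos s • x + Real.sin s • z) x
  rw [Real.dist_eq, dist_eq_norm] at h1
  have hc : |Real.cos s - 1| ≤ |s| := by
    have := Real.abs_cos_sub_cos_le s 0
    simpa using this
  have hs : |Real.sin s| ≤ |s| := Real.abs_sin_le_abs
  have h2 : ‖Real.cos s • x + Real.sin s • z - x‖ ≤ |s| * (‖x‖ + ‖z‖) := by
    rw [show Real.cos s • x + Real.sin s • z - x = (Real.cos s - 1) • x + Real.sin s • z by module]
    refine (norm_add_le _ _).trans ?_
    rw [norm_smul, norm_smul, Real.norm_eq_abs, Real.norm_eq_abs, mul_add]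
    gcongr
  calc _ ≤ _ := h1
    _ ≤ K * (|s| * (‖x‖ + ‖z‖)) := by gcongr
    _ = _ := by ring

/-- Cutting the angle into `n + 1` equal pieces turns the variation into difference quotients at
angle `0`, where the velocity of the curve is `z`. They converge almost everywhere by Rademacher,
and the Lipschitz bound dominates them uniformly in `n`. -/
theorem tendsto_nat_mul_rotationVariation {K : NNReal} {g : 𝕍 → ℝ} (hK : LipschitzWith K g)
    (θ : ℝ) :
    Tendsto (fun n : ℕ => ((n + 1 : ℕ) : ℝ) * rotationVariation g (θ / (n + 1 : ℕ))) atTop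
      (𝓝 (∫ w : 𝕍 × 𝕍, |θ * fderiv ℝ g w.1 w.2| ∂((γ).prod γ))) := by
  simp_rw [rotationVariation, ← integral_const_mul]
  have hgm : Measurable g := hK.continuous.measurable
  refine tendsto_integral_of_dominated_convergence
    (fun w : 𝕍 × 𝕍 => |θ| * (K * (‖w.1‖ + ‖w.2‖))) (fun n => ?_) ?_ (fun n => ?_) ?_
  · have h1 : Measurable fun w : 𝕍 × 𝕍 => g (Real.cos (θ / (n + 1 : ℕ)) • w.1
        + Real.sin (θ / (n + 1 : ℕ)) • w.2) := hgm.comp (by fun_prop)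
    exact ((measurable_norm.comp (h1.sub (hgm.comp measurable_fst))).const_mul
      _).aestronglyMeasurable
  · have hi : Integrable (fun x : 𝕍 => ‖x‖) γ := IsGaussian.integrable_id.norm
    exact (((hi.comp_fst γ).add (hi.comp_snd γ)).const_mul _).const_mul _
  · refine ae_of_all _ fun w => ?_
    rw [Real.norm_of_nonneg (by positivity)]
    have hn : (0 : ℝ) < (n + 1 : ℕ) := by positivity
    calc _ ≤ ((n + 1 : ℕ) : ℝ) * (|θ / (n + 1 : ℕ)| * (K * (‖w.1‖ + ‖w.2‖))) := by
          gcongr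
          exact abs_rotation_sub_le hK _ _ _
      _ = _ := by
          rw [abs_div, abs_of_pos hn]
          field_simp
  · have hdiff : ∀ᵐ x ∂γ, DifferentiableAt ℝ g x :=
      stdGaussian_absolutelyContinuous.ae_le hK.ae_differentiableAt
    have hdiff' : ∀ᵐ w ∂((γ).prod γ), DifferentiableAt ℝ g w.1 :=
      Measure.quasiMeasurePreserving_fst.ae hdiff
    filter_upwards [hdiff'] with w hw
    have hd := hasDerivAt_rotation hw w.2
    have hcomp : HasDerivAt (fun r => g (Real.cos (θ * r) • w.1 + Real.sin (θ * r) • w.2))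
        (θ * fderiv ℝ g w.1 w.2) 0 := by
      have h1 : HasDerivAt (fun r : ℝ => θ * r) θ 0 := by
        simpa using (hasDerivAt_id (0 : ℝ)).const_mul θ
      have h2 : HasDerivAt (fun s => g (Real.cos s • w.1 + Real.sin s • w.2))
        (fderiv ℝ g w.1 w.2) (θ * 0) := by simpa using hd
      have := h2.comp (0 : ℝ) h1
      rwa [mul_comm] at this
    have hlim := hcomp.tendsto_slope_zero
    have hseq : Tendsto (fun n : ℕ => (((n + 1 : ℕ) : ℝ))⁻¹) atTop (𝓝[≠] 0) := by
      rw [tendsto_nhdsWithin_iff]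
      refine ⟨?_, Eventually.of_forall fun n => by simp; positivity⟩
      have := tendsto_one_div_add_atTop_nhds_zero_nat (𝕜 := ℝ)
      simpa using this
    have := (hlim.comp hseq).abs
    refine this.congr fun n => ?_
    have hn : (0 : ℝ) < (n + 1 : ℕ) := by positivity
    simp only [Function.comp_apply, inv_inv, smul_eq_mul, zero_add, mul_zero, Real.cos_zero,
      Real.sin_zero, one_smul, zero_smul, add_zero, div_eq_mul_inv]
    rw [abs_mul, abs_of_pos hn]

/-- Under `γ` the functional is centred with variance `‖ℓ‖²`. -/
theorem integral_abs_strongDual_le (ℓ : StrongDual ℝ 𝕍) : ∫ z, |ℓ z| ∂γ ≤ ‖ℓ‖ := by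
  have hm : MemLp ℓ 2 γ := ℓ.comp_memLp' IsGaussian.memLp_two_id
  refine integral_abs_le_of_integral_sq_le hm (norm_nonneg _) ?_
  rw [← variance_dual_stdGaussian, variance_of_integral_eq_zero (by fun_prop)
    (integral_strongDual_stdGaussian ℓ)]

/-- A Gaussian `L¹` Poincaré-type inequality along rotations. -/
theorem rotationVariation_le_integral_fderiv {K : NNReal} {g : 𝕍 → ℝ} (hK : LipschitzWith K g)
    (hb : ∀ x, |g x| ≤ 1) {θ : ℝ} (hθ : 0 ≤ θ) :
    rotationVariation g θ ≤ θ * ∫ x, ‖fderiv ℝ g x‖ ∂γ := by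
  have hgm : Measurable g := hK.continuous.measurable
  have h1 : rotationVariation g θ ≤ ∫ w : 𝕍 × 𝕍, |θ * fderiv ℝ g w.1 w.2| ∂((γ).prod γ) := by
    refine ge_of_tendsto' (tendsto_nat_mul_rotationVariation hK θ) fun n => ?_
    have hn : ((n + 1 : ℕ) : ℝ) ≠ 0 := by positivity
    have := rotationVariation_nat_mul_le hgm hb (n + 1) (θ / (n + 1 : ℕ))
    rwa [mul_div_cancel₀ _ hn] at this
  have hdm : Measurable (fderiv ℝ g) := measurable_fderiv ℝ g
  have hnorm : Integrable (fun x => ‖fderiv ℝ g x‖) γ :=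
    integrable_of_abs_le (c := K) hdm.norm fun x => by
      rw [abs_norm]; exact norm_fderiv_le_of_lipschitz ℝ hK
  have hmeas : Measurable fun w : 𝕍 × 𝕍 => fderiv ℝ g w.1 w.2 := by
    have hc : Continuous fun q : StrongDual ℝ 𝕍 × 𝕍 => q.1 q.2 := by fun_prop
    exact hc.measurable.comp ((hdm.comp measurable_fst).prodMk measurable_snd)
  have hint : Integrable (fun w : 𝕍 × 𝕍 => |θ * fderiv ℝ g w.1 w.2|) ((γ).prod γ) := by
    refine ((((IsGaussian.integrable_id (μ := γ)).norm.comp_snd γ).const_mul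
      (K : ℝ)).const_mul θ).mono' (measurable_norm.comp (hmeas.const_mul θ)).aestronglyMeasurable
        (ae_of_all _ fun w => ?_)
    rw [norm_abs_eq_norm, norm_mul, Real.norm_of_nonneg hθ]
    refine mul_le_mul_of_nonneg_left ?_ hθ
    refine (ContinuousLinearMap.le_opNorm _ _).trans ?_
    exact mul_le_mul_of_nonneg_right (norm_fderiv_le_of_lipschitz ℝ hK) (norm_nonneg _)
  refine h1.trans ?_
  rw [integral_prod _ hint, ← integral_const_mul]
  refine integral_mono hint.integral_prod_left (hnorm.const_mul θ) fun x => ?_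
  simp only [abs_mul, abs_of_nonneg hθ]
  rw [integral_const_mul]
  exact mul_le_mul_of_nonneg_left (integral_abs_strongDual_le _) hθ

section Thickened

variable {δ : ℝ} (hδ : 0 < δ) (H : Set (EuclideanSpace ℝ (Fin d)))

/-- On `H` the cutoff attains its maximum and off the thickening its minimum, so the derivative
vanishes there; `fderiv` is zero at an extremum even where the cutoff fails to be differentiable. In
between, the Lipschitz constant `δ⁻¹` is the bound. -/
theorem norm_fderiv_thickenedIndicator_le (x : 𝕍) :
    ‖fderiv ℝ (fun y => (thickenedIndicator hδ H y : ℝ)) x‖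
      ≤ (Metric.thickening δ H \ H).indicator (fun _ => δ⁻¹) x := by
  by_cases hx : x ∈ H
  · have : IsLocalMax (fun y => (thickenedIndicator hδ H y : ℝ)) x := by
      refine Eventually.of_forall fun y => ?_
      simp only [thickenedIndicator_one hδ H hx]
      exact_mod_cast thickenedIndicator_le_one hδ H y
    rw [this.fderiv_eq_zero]
    simp [hx]
  by_cases hx' : x ∈ Metric.thickening δ H
  · rw [Set.indicator_of_mem (s := Metric.thickening δ H \ H) ⟨hx', hx⟩]
    have hL : LipschitzWith δ.toNNReal⁻¹ (fun y => (thickenedIndicator hδ H y : ℝ)) :=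
      lipschitzWith_thickenedIndicator hδ H
    refine (norm_fderiv_le_of_lipschitz ℝ hL).trans ?_
    simp [hδ.le]
  · have : IsLocalMin (fun y => (thickenedIndicator hδ H y : ℝ)) x := by
      refine Eventually.of_forall fun y => ?_
      simp only [thickenedIndicator_zero hδ H hx']
      exact NNReal.coe_nonneg _
    rw [this.fderiv_eq_zero]
    simp [hx']

theorem abs_indicator_sub_thickenedIndicator_le (x : 𝕍) :
    |H.indicator (fun _ => (1 : ℝ)) x - (thickenedIndicator hδ H x : ℝ)|
      ≤ (Metric.thickening δ H \ H).indicator (fun _ => (1 : ℝ)) x := by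
  by_cases hx : x ∈ H
  · simp [hx, thickenedIndicator_one hδ H hx]
  by_cases hx' : x ∈ Metric.thickening δ H
  · rw [Set.indicator_of_mem (s := Metric.thickening δ H \ H) ⟨hx', hx⟩]
    have := thickenedIndicator_le_one hδ H x
    simpa [hx] using this
  · simp [hx, hx', thickenedIndicator_zero hδ H hx']

end Thickened

theorem abs_indicator_one_le (H : Set 𝕍) (x : 𝕍) : |H.indicator (fun _ => (1 : ℝ)) x| ≤ 1 := by
  by_cases hx : x ∈ H <;> simp [hx]

/-- The cutoff contributes `θ/δ` times the measure of the shell. The term `2δ` pays for replacing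
the indicator by the cutoff at both ends of the rotation, each costing one shell measure. -/
theorem rotationVariation_indicator_le_thickening {H : Set 𝕍} (hH : MeasurableSet H) {θ δ : ℝ}
    (hθ : 0 ≤ θ) (hδ : 0 < δ) :
    rotationVariation (H.indicator fun _ => (1 : ℝ)) θ
      ≤ (θ + 2 * δ) * ((γ).real (Metric.thickening δ H \ H) / δ) := by
  set g : 𝕍 → ℝ := fun y => (thickenedIndicator hδ H y : ℝ) with hgdef
  set f : 𝕍 → ℝ := H.indicator fun _ => (1 : ℝ) with hfdef
  have hL : LipschitzWith δ.toNNReal⁻¹ g := lipschitzWith_thickenedIndicator hδ H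
  have hgm : Measurable g := hL.continuous.measurable
  have hgb (x : 𝕍) : |g x| ≤ 1 := by
    rw [abs_of_nonneg (NNReal.coe_nonneg _)]
    exact_mod_cast thickenedIndicator_le_one hδ H x
  have hfm : Measurable f := measurable_const.indicator hH
  have hfb (x : 𝕍) : |f x| ≤ 1 := abs_indicator_one_le H x
  have hD : MeasurableSet (Metric.thickening δ H \ H) :=
    Metric.isOpen_thickening.measurableSet.diff hH
  have hgrad : ∫ x, ‖fderiv ℝ g x‖ ∂γ ≤ δ⁻¹ * (γ).real (Metric.thickening δ H \ H) := by
    calc _ ≤ ∫ x, (Metric.thickening δ H \ H).indicator (fun _ => δ⁻¹) x ∂γ :=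
          integral_mono_of_nonneg (ae_of_all _ fun x => norm_nonneg _)
            ((integrable_const _).indicator hD)
            (ae_of_all _ (norm_fderiv_thickenedIndicator_le hδ H))
      _ = _ := by rw [integral_indicator_const _ hD, smul_eq_mul, mul_comm]
  have hdiff : ∫ x, |f x - g x| ∂γ ≤ (γ).real (Metric.thickening δ H \ H) := by
    calc _ ≤ ∫ x, (Metric.thickening δ H \ H).indicator (fun _ => (1 : ℝ)) x ∂γ :=
          integral_mono_of_nonneg (ae_of_all _ fun x => abs_nonneg _)
            ((integrable_const _).indicator hD)
            (ae_of_all _ (abs_indicator_sub_thickenedIndicator_le hδ H))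
      _ = _ := by rw [integral_indicator_const _ hD]; simp
  have hfst : ∫ w, |f w.1 - g w.1| ∂((γ).prod γ) = ∫ x, |f x - g x| ∂γ := by
    rw [integral_fun_fst (fun x => |f x - g x|)]; simp
  have hrot : ∫ w, |f (Real.cos θ • w.1 + Real.sin θ • w.2)
      - g (Real.cos θ • w.1 + Real.sin θ • w.2)| ∂((γ).prod γ) = ∫ x, |f x - g x| ∂γ := by
    rw [← hfst, ← integral_comp_rotation θ (F := fun w : 𝕍 × 𝕍 => |f w.1 - g w.1|)]
    · rfl
    · exact (measurable_norm.comp ((hfm.sub hgm).comp measurable_fst)).aestronglyMeasurable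
  have i1 := integrable_rotation_abs_sub hfm hfb hgm hgb θ θ
  have i2 : Integrable (fun w : 𝕍 × 𝕍 =>
      |g (Real.cos θ • w.1 + Real.sin θ • w.2) - g w.1|) ((γ).prod γ) := by
    simpa using integrable_rotation_abs_sub hgm hgb hgm hgb θ 0
  have i3 : Integrable (fun w : 𝕍 × 𝕍 => |f w.1 - g w.1|) ((γ).prod γ) := by
    simpa using integrable_rotation_abs_sub hfm hfb hgm hgb 0 0
  have i4 : Integrable (fun w : 𝕍 × 𝕍 =>
      |f (Real.cos θ • w.1 + Real.sin θ • w.2) - f w.1|) ((γ).prod γ) := by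
    simpa using integrable_rotation_abs_sub hfm hfb hfm hfb θ 0
  have htri : rotationVariation f θ ≤ ∫ x, |f x - g x| ∂γ + rotationVariation g θ
      + ∫ x, |f x - g x| ∂γ := by
    nth_rewrite 1 [← hrot]
    rw [← hfst, rotationVariation, rotationVariation, ← integral_add i1 i2,
      ← integral_add (i1.fun_add i2) i3]
    refine integral_mono i4 ((i1.fun_add i2).fun_add i3) fun w => ?_
    have e1 := abs_sub_le (f (Real.cos θ • w.1 + Real.sin θ • w.2))
      (g (Real.cos θ • w.1 + Real.sin θ • w.2)) (f w.1)
    have e2 := abs_sub_le (g (Real.cos θ • w.1 + Real.sin θ • w.2)) (g w.1) (f w.1)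
    rw [abs_sub_comm (g w.1) (f w.1)] at e2
    simp only
    linarith
  have hg := rotationVariation_le_integral_fderiv hL hgb hθ
  have hg' := mul_le_mul_of_nonneg_left hgrad hθ
  calc _ ≤ _ := htri
    _ ≤ θ * (δ⁻¹ * (γ).real (Metric.thickening δ H \ H))
        + 2 * (γ).real (Metric.thickening δ H \ H) := by linarith
    _ = _ := by field_simp

/-- Gaussian surface area controls the noise sensitivity of a set. -/
theorem rotationVariation_indicator_le {H : Set 𝕍} (hH : MeasurableSet H)
    (hΓ : gaussianSurfaceArea H ≠ ⊤) {θ : ℝ} (hθ : 0 ≤ θ) :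
    rotationVariation (H.indicator fun _ => (1 : ℝ)) θ
      ≤ θ * (gaussianSurfaceArea H).toReal := by
  set Γ := (gaussianSurfaceArea H).toReal
  have key (η : ℝ) (hη : 0 < η) :
      rotationVariation (H.indicator fun _ => (1 : ℝ)) θ ≤ (θ + 2 * η) * (Γ + η) := by
    have hlt : gaussianSurfaceArea H < ENNReal.ofReal (Γ + η) := by
      rw [← ENNReal.ofReal_toReal hΓ]
      exact (ENNReal.ofReal_lt_ofReal_iff (by positivity)).2 (by simp [Γ, hη])
    -- A liminf gives good values of `δ` only frequently, which suffices: a single one below `η` is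
    -- needed.
    have hfr := frequently_lt_of_liminf_lt (by isBoundedDefault) hlt
    have hmem : ∀ᶠ δ : ℝ in 𝓝[>] 0, δ ∈ Set.Ioo 0 η := Ioo_mem_nhdsGT hη
    obtain ⟨δ, hδ, hδ0, hδη⟩ := (hfr.and_eventually hmem).exists
    refine (rotationVariation_indicator_le_thickening hH hθ hδ0).trans ?_
    have hA : (γ).real (Metric.thickening δ H \ H) / δ ≤ Γ + η := by
      have := ENNReal.toReal_mono ENNReal.ofReal_ne_top hδ.le
      rwa [ENNReal.toReal_div, ENNReal.toReal_ofReal hδ0.le,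
        ENNReal.toReal_ofReal (by positivity)] at this
    gcongr
  have hlim : Tendsto (fun η : ℝ => (θ + 2 * η) * (Γ + η)) (𝓝[>] 0) (𝓝 (θ * Γ)) := by
    have : Continuous fun η : ℝ => (θ + 2 * η) * (Γ + η) := by fun_prop
    have := (this.tendsto 0).mono_left (nhdsWithin_le_nhds (s := Set.Ioi 0))
    simpa using this
  refine ge_of_tendsto hlim ?_
  filter_upwards [self_mem_nhdsWithin] with η hη using key η hη

end SurfaceArea

/-! ### From noise sensitivity to the `L¹` error of `p` and of `(1 + p)²/4`. -/

section Approximation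

variable {d : ℕ}

local notation "𝕍" => EuclideanSpace ℝ (Fin d)
local notation "γ" => stdGaussian (EuclideanSpace ℝ (Fin d))

theorem measurable_signFn {H : Set 𝕍} (hH : MeasurableSet H) : Measurable (signFn H) :=
  ((measurable_const.indicator hH).const_mul 2).sub_const 1

theorem abs_signFn (H : Set 𝕍) (x : 𝕍) : |signFn H x| = 1 := by
  by_cases hx : x ∈ H <;> norm_num [signFn, hx]

/-- The `L¹` distance between a set and its smoothing is controlled by the surface area. -/
theorem integral_abs_ornsteinUhlenbeck_sub_le {H : Set 𝕍} (hH : MeasurableSet H)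
    (hΓ : gaussianSurfaceArea H ≠ ⊤) {θ : ℝ} (hθ : 0 ≤ θ) (hπ : θ ≤ Real.pi) :
    ∫ x, |ornsteinUhlenbeck (Real.cos θ) (signFn H) x - signFn H x| ∂γ
      ≤ 2 * (θ * (gaussianSurfaceArea H).toReal) := by
  have hfm := measurable_signFn hH
  have hfb (x : 𝕍) : |signFn H x| ≤ 1 := (abs_signFn H x).le
  have hint : Integrable (fun w : 𝕍 × 𝕍 =>
      |signFn H (Real.cos θ • w.1 + Real.sin θ • w.2) - signFn H w.1|) ((γ).prod γ) := by
    simpa using integrable_rotation_abs_sub hfm hfb hfm hfb θ 0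
  calc _ ≤ ∫ x, ∫ z, |signFn H (Real.cos θ • x + Real.sin θ • z) - signFn H x| ∂γ ∂γ := by
        refine integral_mono_of_nonneg (ae_of_all _ fun x => abs_nonneg _)
          hint.integral_prod_left (ae_of_all _ fun x => ?_)
        have hm : Measurable fun z : 𝕍 => signFn H (Real.cos θ • x + Real.sin θ • z) :=
          hfm.comp (by fun_prop)
        have hi : Integrable (fun z : 𝕍 => signFn H (Real.cos θ • x + Real.sin θ • z)) γ :=
          integrable_of_abs_le hm fun z => hfb _
        have h1 : ornsteinUhlenbeck (Real.cos θ) (signFn H) x - signFn H x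
            = ∫ z, (signFn H (Real.cos θ • x + Real.sin θ • z) - signFn H x) ∂γ := by
          rw [integral_sub hi (integrable_const _), ornsteinUhlenbeck_cos hθ hπ]
          simp
        simp only
        rw [h1]
        exact abs_integral_le_integral_abs
    _ = ∫ w, |signFn H (Real.cos θ • w.1 + Real.sin θ • w.2) - signFn H w.1| ∂((γ).prod γ) :=
        (integral_prod _ hint).symm
    _ = 2 * rotationVariation (H.indicator fun _ => (1 : ℝ)) θ := by
        rw [rotationVariation, ← integral_const_mul]
        congr 1; ext w
        rw [signFn, signFn, ← abs_of_pos (two_pos (α := ℝ)), ← abs_mul,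
          abs_of_pos (two_pos (α := ℝ))]
        congr 1; ring
    _ ≤ _ := by
        have := rotationVariation_indicator_le hH hΓ hθ
        linarith

/-- Here `(1 + signFn H x)/2` is the indicator, so the right side is the signed error of the square
plus `|u - f| + (f - u)`. Signed errors integrate to something controlled by means and second
moments alone. For `x ∈ H` and `u ≤ 1` the inequality reduces to `(u - 1)² ≥ 0`. -/
theorem abs_sq_sub_indicator_le (H : Set 𝕍) (x : 𝕍) (u : ℝ) :
    |1 / 4 * (1 + u) ^ 2 - H.indicator (fun _ => (1 : ℝ)) x|
      ≤ (1 / 4 * (1 + 2 * u + u ^ 2) - (1 + signFn H x) / 2)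
        + |u - signFn H x| + (signFn H x - u) := by
  by_cases hx : x ∈ H
  · have hs : signFn H x = 1 := by norm_num [signFn, hx]
    rw [hs, Set.indicator_of_mem hx]
    rcases le_total 1 u with h | h
    · rw [abs_of_nonneg (by nlinarith), abs_of_nonneg (by linarith)]
      nlinarith
    · rw [abs_of_nonpos (a := u - 1) (by linarith)]
      refine abs_le'.2 ⟨by nlinarith, by nlinarith [sq_nonneg (u - 1)]⟩
  · have hs : signFn H x = -1 := by norm_num [signFn, hx]
    rw [hs, Set.indicator_of_notMem hx, sub_zero, abs_of_nonneg (by positivity)]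
    have := neg_abs_le (u - -1)
    have := le_abs_self (u - -1)
    nlinarith

/-- Squaring an approximation of `2 · 1_H - 1` with the same mean and norm at most one does not
increase the `L¹` error. -/
theorem integral_abs_sq_sub_indicator_le {H : Set 𝕍} (hH : MeasurableSet H) {u : 𝕍 → ℝ}
    (hu : MemLp u 2 γ) (hmean : ∫ x, u x ∂γ = ∫ x, signFn H x ∂γ)
    (hsq : ∫ x, u x ^ 2 ∂γ ≤ 1) :
    ∫ x, |1 / 4 * (1 + u x) ^ 2 - H.indicator (fun _ => (1 : ℝ)) x| ∂γ
      ≤ ∫ x, |u x - signFn H x| ∂γ := by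
  have hf : Integrable (signFn H) γ :=
    integrable_of_abs_le (measurable_signFn hH) fun x => (abs_signFn H x).le
  have hui : Integrable u γ := hu.integrable (by simp)
  have hus : Integrable (fun x => u x ^ 2) γ := hu.integrable_sq
  have c1 : Integrable (fun _ : 𝕍 => (1 : ℝ)) γ := integrable_const _
  have j1 : Integrable (fun x => 1 + 2 * u x) γ := c1.add (hui.const_mul 2)
  have j2 : Integrable (fun x => 1 / 4 * (1 + 2 * u x + u x ^ 2)) γ := (j1.add hus).const_mul _
  have j3 : Integrable (fun x => (1 + signFn H x) / 2) γ := (c1.add hf).div_const 2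
  have j4 : Integrable (fun x => |u x - signFn H x|) γ := (hui.sub hf).abs
  have j5 : Integrable (fun x => signFn H x - u x) γ := hf.sub hui
  have j7 : Integrable (fun x => 1 / 4 * (1 + 2 * u x + u x ^ 2) - (1 + signFn H x) / 2) γ :=
    j2.sub j3
  have j6 : Integrable (fun x => 1 / 4 * (1 + 2 * u x + u x ^ 2) - (1 + signFn H x) / 2
      + |u x - signFn H x|) γ := j7.add j4
  calc _ ≤ ∫ x, ((1 / 4 * (1 + 2 * u x + u x ^ 2) - (1 + signFn H x) / 2)
        + |u x - signFn H x| + (signFn H x - u x)) ∂γ :=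
        integral_mono_of_nonneg (ae_of_all _ fun x => abs_nonneg _) (j6.add j5)
          (ae_of_all _ fun x => abs_sq_sub_indicator_le H x (u x))
    _ = (1 / 4 * (1 + 2 * ∫ x, u x ∂γ + ∫ x, u x ^ 2 ∂γ) - (1 + ∫ x, signFn H x ∂γ) / 2)
        + ∫ x, |u x - signFn H x| ∂γ + (∫ x, signFn H x ∂γ - ∫ x, u x ∂γ) := by
        rw [integral_add j6 j5, integral_add j7 j4, integral_sub j2 j3,
          integral_sub hf hui, integral_const_mul, integral_add j1 hus,
          integral_add c1 (hui.const_mul 2), integral_const_mul, integral_div,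
          integral_add c1 hf]
        simp
    _ ≤ _ := by
        -- Equal means cancel the last bracket. With `E u² ≤ 1` the first is at most `(2 + 2 E f)/4
        -- - (1 + E f)/2 = 0`.
        rw [hmean]
        linarith

theorem integral_abs_hermiteTrunc_sub_signFn_le {H : Set 𝕍} (hH : MeasurableSet H)
    (hΓ : gaussianSurfaceArea H ≠ ⊤) {θ : ℝ} (hθ : 0 ≤ θ) (hπ : θ ≤ Real.pi / 2) (t : ℕ) :
    ∫ x, |evalAt (hermiteTrunc t (ornsteinUhlenbeck (Real.cos θ) (signFn H))) x
      - signFn H x| ∂γ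
      ≤ Real.cos θ ^ (t + 1) + 2 * (θ * (gaussianSurfaceArea H).toReal) := by
  have hfm := measurable_signFn hH
  have hfb (x : 𝕍) : |signFn H x| ≤ 1 := (abs_signFn H x).le
  have hπ' : θ ≤ Real.pi := by linarith
  have h1 := integral_abs_hermiteTrunc_sub_le hθ hπ hfm hfb t
  have h2 := integral_abs_ornsteinUhlenbeck_sub_le hH hΓ hθ hπ'
  have hf : Integrable (signFn H) γ := integrable_of_abs_le hfm hfb
  have hg : Integrable (ornsteinUhlenbeck (Real.cos θ) (signFn H)) γ :=
    memLp_one_iff_integrable.1 (memLp_ornsteinUhlenbeck _ hfm hfb 1)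
  have hp := integrable_evalAt (hermiteTrunc t (ornsteinUhlenbeck (Real.cos θ) (signFn H)))
  refine le_trans ?_ (add_le_add h1 h2)
  have k1 : Integrable (fun x => |evalAt (hermiteTrunc t (ornsteinUhlenbeck (Real.cos θ)
      (signFn H))) x - ornsteinUhlenbeck (Real.cos θ) (signFn H) x|) γ := (hp.sub hg).abs
  have k2 : Integrable (fun x => |ornsteinUhlenbeck (Real.cos θ) (signFn H) x
      - signFn H x|) γ := (hg.sub hf).abs
  rw [← integral_add k1 k2]
  exact integral_mono (hp.sub hf).abs (k1.add k2)
    fun x => abs_sub_le _ _ _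

end Approximation

/-! ### Choice of parameters. -/

theorem cos_le_exp_neg_sq {θ : ℝ} (h0 : 0 ≤ θ) (hπ : θ ≤ Real.pi / 2) :
    Real.cos θ ≤ Real.exp (-(θ ^ 2 / 5)) := by
  have h1 := Real.cos_le_one_sub_mul_cos_sq (x := θ) (abs_le.2 ⟨by linarith, by linarith⟩)
  -- The constant `5` comes from `cos θ ≤ 1 - 2θ²/π²` and `π² < 10`.
  have h2 : (1 : ℝ) / 5 ≤ 2 / Real.pi ^ 2 := by
    rw [div_le_div_iff₀ (by norm_num) (by positivity)]
    nlinarith [Real.pi_lt_d2, Real.pi_pos]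
  have h3 := Real.add_one_le_exp (-(θ ^ 2 / 5))
  nlinarith [sq_nonneg θ]

theorem log_two_div_le {ε : ℝ} (h0 : 0 < ε) (h1 : ε < 1 / 2) :
    Real.log (2 / ε) ≤ 2 * Real.log (1 / ε) := by
  rw [show (2 : ℝ) / ε = 2 * (1 / ε) by ring, Real.log_mul (by norm_num) (by positivity)]
  have : Real.log 2 ≤ Real.log (1 / ε) :=
    Real.log_le_log (by norm_num) (by rw [le_div_iff₀ h0]; linarith)
  linarith

/-- Choice of the noise parameter `cos θ` and the truncation degree `t`. -/
theorem exists_angle_degree {G ε : ℝ} (hG : 0 ≤ G) (h0 : 0 < ε) (h1 : ε < 1 / 2) :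
    ∃ (θ : ℝ) (t : ℕ), 0 ≤ θ ∧ θ ≤ Real.pi / 2 ∧
      Real.cos θ ^ (t + 1) + 2 * (θ * G) ≤ ε ∧
      2 * (t : ℝ) ≤ 320 * (G ^ 2 / ε ^ 2 * Real.log (1 / ε)) := by
  have hlog : 0 ≤ Real.log (1 / ε) :=
    Real.log_nonneg (by rw [le_div_iff₀ h0]; linarith)
  -- If `G` is this small, including `G = 0`, a constant polynomial works: `θ = π/2` gives `ρ = 0`,
  -- and `t = 0`. Otherwise `ε/(4G) ≤ π/2` is an admissible angle.
  rcases le_or_gt (2 * Real.pi * G) ε with h | h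
  · refine ⟨Real.pi / 2, 0, by positivity, le_rfl, ?_, ?_⟩
    · have : 0 ≤ Real.pi * G := by positivity
      rw [Real.cos_pi_div_two]
      norm_num
      linarith
    · simp only [Nat.cast_zero, mul_zero]
      positivity
  · have hGpos : 0 < G := by
      rcases hG.eq_or_lt with rfl | hG
      · simp at h; linarith
      · exact hG
    -- Chosen so that the smoothing error `2θG` is exactly `ε/2`.
    set θ := ε / (4 * G) with hθ
    have hθ0 : 0 ≤ θ := by positivity
    have hθπ : θ ≤ Real.pi / 2 := by
      rw [hθ, div_le_div_iff₀ (by positivity) (by norm_num)]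
      linarith
    -- `A` solves `A θ²/5 = log(2/ε)`, whence `80 = 5 · 4²`. Rounding down is harmless because the
    -- tail exponent is `t + 1`. With `log(2/ε) ≤ 2 log(1/ε)`, the bound on `2t` has constant `2 ·
    -- 80 · 2 = 320`.
    set A := 80 * (G ^ 2 / ε ^ 2) * Real.log (2 / ε) with hA
    have hlog2 : 0 ≤ Real.log (2 / ε) :=
      Real.log_nonneg (by rw [le_div_iff₀ h0]; linarith)
    have hA0 : 0 ≤ A := by positivity
    refine ⟨θ, ⌊A⌋₊, hθ0, hθπ, ?_, ?_⟩
    · have hcos : 0 ≤ Real.cos θ :=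
        Real.cos_nonneg_of_mem_Icc ⟨by linarith [Real.pi_pos], hθπ⟩
      have hpow : Real.cos θ ^ (⌊A⌋₊ + 1) ≤ ε / 2 := by
        calc _ ≤ Real.exp (-(θ ^ 2 / 5)) ^ (⌊A⌋₊ + 1) :=
              pow_le_pow_left₀ hcos (cos_le_exp_neg_sq hθ0 hθπ) _
          _ = Real.exp (((⌊A⌋₊ + 1 : ℕ) : ℝ) * -(θ ^ 2 / 5)) := by rw [Real.exp_nat_mul]
          _ ≤ Real.exp (-Real.log (2 / ε)) := by
              rw [Real.exp_le_exp, mul_neg, neg_le_neg_iff]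
              have hfl : A ≤ ((⌊A⌋₊ + 1 : ℕ) : ℝ) := by
                push_cast
                exact (Nat.lt_floor_add_one A).le
              have heq : A * (θ ^ 2 / 5) = Real.log (2 / ε) := by
                rw [hA, hθ]
                field_simp
                ring
              rw [← heq]
              exact mul_le_mul_of_nonneg_right hfl (by positivity)
          _ = ε / 2 := by
              rw [Real.exp_neg, Real.exp_log (by positivity), inv_div]
      have : 2 * (θ * G) = ε / 2 := by
        rw [hθ]; field_simp; ring
      linarith
    · have hfl := Nat.floor_le hA0
      have := mul_le_mul_of_nonneg_left (log_two_div_le h0 h1)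
        (show 0 ≤ 80 * (G ^ 2 / ε ^ 2) by positivity)
      linarith

end GSAApprox

/-! ### Assembly of the main theorem. -/

theorem theorem1 :
    ∃ C : ℝ, 0 < C ∧
      ∀ (d : ℕ) (𝓗 : Set (Set (EuclideanSpace ℝ (Fin d)))),
        (∀ H ∈ 𝓗, MeasurableSet H) →
        GSAApprox.classSurfaceArea 𝓗 < ⊤ →
        ∀ H ∈ 𝓗, ∀ ε : ℝ, 0 < ε → ε < 1 / 2 →
          ∃ q : MvPolynomial (Fin d) ℝ,
            (∀ x, 0 ≤ GSAApprox.evalAt q x) ∧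
            Integrable (fun x => |GSAApprox.evalAt q x - H.indicator (fun _ => (1 : ℝ)) x|)
              (stdGaussian (EuclideanSpace ℝ (Fin d))) ∧
            ∫ x, |GSAApprox.evalAt q x - H.indicator (fun _ => (1 : ℝ)) x|
              ∂(stdGaussian (EuclideanSpace ℝ (Fin d))) ≤ ε ∧
            (q.totalDegree : ℝ) ≤
              C * ((GSAApprox.classSurfaceArea 𝓗).toReal ^ 2 / ε ^ 2
                * Real.log (1 / ε)) ∧
            -- the construction, and the comparison with the unconstrained approximation `p`
            ∃ (ρ : ℝ) (t : ℕ) (p : MvPolynomial (Fin d) ℝ), 0 ≤ ρ ∧ ρ ≤ 1 ∧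
              p = GSAApprox.hermiteTrunc t
                (GSAApprox.ornsteinUhlenbeck ρ (GSAApprox.signFn H)) ∧
              q = MvPolynomial.C (1 / 4) * (1 + p) ^ 2 ∧
              p.totalDegree ≤ t ∧
              q.totalDegree ≤ 2 * t ∧
              2 * (t : ℝ) ≤
                C * ((GSAApprox.classSurfaceArea 𝓗).toReal ^ 2 / ε ^ 2
                  * Real.log (1 / ε)) ∧
              Integrable (fun x => |GSAApprox.evalAt p x - GSAApprox.signFn H x|)
                (stdGaussian (EuclideanSpace ℝ (Fin d))) ∧
              ∫ x, |GSAApprox.evalAt p x - GSAApprox.signFn H x|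
                ∂(stdGaussian (EuclideanSpace ℝ (Fin d))) ≤ ε := by
  refine ⟨320, by norm_num, fun d 𝓗 hmeas hfin H hH ε hε hε' => ?_⟩
  have hle : GSAApprox.gaussianSurfaceArea H ≤ GSAApprox.classSurfaceArea 𝓗 :=
    le_iSup₂ (f := fun K (_ : K ∈ 𝓗) => GSAApprox.gaussianSurfaceArea K) H hH
  have hΓ : GSAApprox.gaussianSurfaceArea H ≠ ⊤ := (hle.trans_lt hfin).ne
  have hΓle := ENNReal.toReal_mono hfin.ne hle
  have hHm := hmeas H hH
  -- The parameters are chosen from the supremum over the class; monotonicity then covers the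
  -- individual `H`.
  obtain ⟨θ, t, hθ, hθπ, herr, hdeg⟩ :=
    GSAApprox.exists_angle_degree (G := (GSAApprox.classSurfaceArea 𝓗).toReal)
      ENNReal.toReal_nonneg hε hε'
  have hθπ' : θ ≤ Real.pi := by linarith [Real.pi_pos]
  have hfm := GSAApprox.measurable_signFn hHm
  have hfb : ∀ x, |GSAApprox.signFn H x| ≤ 1 := fun x => (GSAApprox.abs_signFn H x).le
  set p := GSAApprox.hermiteTrunc t
    (GSAApprox.ornsteinUhlenbeck (Real.cos θ) (GSAApprox.signFn H))
  have hpε : ∫ x, |GSAApprox.evalAt p x - GSAApprox.signFn H x|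
      ∂(stdGaussian (EuclideanSpace ℝ (Fin d))) ≤ ε := by
    refine (GSAApprox.integral_abs_hermiteTrunc_sub_signFn_le hHm hΓ hθ hθπ t).trans ?_
    have := mul_le_mul_of_nonneg_left hΓle hθ
    linarith
  have hpdeg : p.totalDegree ≤ t := GSAApprox.totalDegree_hermiteTrunc_le t _
  have hqdeg : (MvPolynomial.C (1 / 4) * (1 + p) ^ 2).totalDegree ≤ 2 * t := by
    refine (MvPolynomial.totalDegree_mul _ _).trans ?_
    rw [MvPolynomial.totalDegree_C, zero_add]
    refine (MvPolynomial.totalDegree_pow _ _).trans (Nat.mul_le_mul_left 2 ?_)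
    refine (MvPolynomial.totalDegree_add _ _).trans ?_
    simpa using hpdeg
  have hqeval : ∀ x, GSAApprox.evalAt (MvPolynomial.C (1 / 4) * (1 + p) ^ 2) x
      = 1 / 4 * (1 + GSAApprox.evalAt p x) ^ 2 := fun x => by simp
  have hind : Integrable (H.indicator fun _ => (1 : ℝ))
      (stdGaussian (EuclideanSpace ℝ (Fin d))) := (integrable_const _).indicator hHm
  refine ⟨MvPolynomial.C (1 / 4) * (1 + p) ^ 2, fun x => ?_, ?_, ?_, ?_,
    Real.cos θ, t, p, Real.cos_nonneg_of_mem_Icc ⟨by linarith, hθπ⟩, Real.cos_le_one θ, rfl, rfl,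
    hpdeg, hqdeg, hdeg, ?_, hpε⟩
  · rw [hqeval]; positivity
  · exact ((GSAApprox.integrable_evalAt _).sub hind).abs
  · simp_rw [hqeval]
    exact (GSAApprox.integral_abs_sq_sub_indicator_le hHm
      (GSAApprox.memLp_evalAt p 2 (by simp))
      (GSAApprox.integral_hermiteTrunc_ornsteinUhlenbeck hθ hθπ' hfm hfb t)
      (GSAApprox.integral_sq_hermiteTrunc_le hθ hθπ' hfm hfb t)).trans hpε
  · refine le_trans ?_ hdeg
    exact_mod_cast hqdeg
  · exact ((GSAApprox.integrable_evalAt p).sub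
      (GSAApprox.integrable_of_abs_le hfm hfb)).abs
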